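/- Let $\Sigma$ be a closed oriented surface of genus $g\ge 0$, with fundamental group $$\Gamma=\langle a_1,b_1,\dots,a_g,b_g \mid [a_1,b_1]\cdots[a_g,b_g]=1\rangle .$$ Let $\mathrm{Aut}^+(\Gamma)$ be the group of automorphisms of $\Gamma$ induced by orientation-preserving maps $\Sigma\to\Sigma$, that is, of those automorphisms that act trivially on $H_2(\Gamma;\mathbb Z)$. It acts by precomposition on $\mathrm{Hom}(\Gamma,\mathrm O_2(\mathbb R))$, which carries the topology of pointwise convergence. Let $\varepsilon:\mathrm O_2(\mathbb R)\to \mathrm O_2(\mathbb R)/\mathrm{SO}_2(\mathbb R)\cong\mathbb Z/2$ be the quotient homomorphism. Embed $\mathrm O_2(\mathbb R)$ in $\mathrm{PSL}_2(\mathbb C)$ by sending $A$ to the Möbius transformation that restricts to $A$ on the unit circle of $\mathbb C=\mathbb R^2$ (a rotation by $\theta$ becomes $z\mapsto e^{i\theta}z$ and a reflection $z\mapsto u\bar z$ becomes $z\mapsto u/z$), equivalently by $A\mapsto \mathrm{diag}(A,\det A)\in \mathrm{SO}_3(\mathbb R)\cong \mathrm{PSU}_2\subset \mathrm{PSL}_2(\mathbb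 C)$. For $\rho\in\mathrm{Hom}(\Gamma,\mathrm O_2(\mathbb R))$ put $\mathrm{sw}(\rho)=0$ if the resulting homomorphism $\Gamma\to\mathrm{PSL}_2(\mathbb C)$ lifts to a homomorphism $\Gamma\to\mathrm{SL}_2(\mathbb C)$, and $\mathrm{sw}(\rho)=1$ otherwise. Let $\rho\in\mathrm{Hom}(\Gamma,\mathrm O_2(\mathbb R))$ have infinite image. Then the closure of the orbit $\mathrm{Aut}^+(\Gamma)\cdot\rho$ in $\mathrm{Hom}(\Gamma,\mathrm O_2(\mathbb R))$ is the set of all $\rho_\infty\in\mathrm{Hom}(\Gamma,\mathrm O_2(\mathbb R))$ such that $\varepsilon\circ\rho_\infty$ and $\varepsilon\circ\rho$ have the same image and $\mathrm{sw}(\rho_\infty)=\mathrm{sw}(\rho)$. -/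

import Mathlib

open scoped commutatorElement in
/-- The relator `[a₁, b₁] ⋯ [a_g, b_g]` in the free group on `a₁, …, a_g` (the generators
`Sum.inl i`) and `b₁, …, b_g` (the generators `Sum.inr i`). -/
def surfaceRelator (g : ℕ) : FreeGroup (Fin g ⊕ Fin g) :=
  (List.ofFn fun i : Fin g =>
    ⁅FreeGroup.of (Sum.inl i : Fin g ⊕ Fin g), FreeGroup.of (Sum.inr i)⁆).prod

/-- The fundamental group `Γ` of the closed oriented surface `Σ` of genus `g`, through its
standard presentation `⟨a₁, b₁, …, a_g, b_g ∣ [a₁, b₁] ⋯ [a_g, b_g] = 1⟩`. -/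
abbrev SurfaceGroup (g : ℕ) : Type :=
  PresentedGroup ({surfaceRelator g} : Set (FreeGroup (Fin g ⊕ Fin g)))

/-- The identity of `ℤ`, from the trivial representation of `G` to the restriction along `f` of the
trivial representation. -/
noncomputable def trivialResHom {G : Type} [Group G] (f : G →* G) :
    Rep.trivial ℤ G ℤ ⟶ Rep.res f (Rep.trivial ℤ G ℤ) :=
  Rep.ofHom ⟨LinearMap.id, fun _ => rfl⟩

/-- The endomorphism of `H₂(G; ℤ)` (trivial coefficients) induced by an endomorphism of `G`. -/
noncomputable def homologyTwoMap {G : Type} [Group G] (f : G →* G) :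
    groupHomology (Rep.trivial ℤ G ℤ) 2 ⟶ groupHomology (Rep.trivial ℤ G ℤ) 2 :=
  groupHomology.map f (trivialResHom f) 2

theorem homologyTwoMap_id {G : Type} [Group G] :
    homologyTwoMap (MonoidHom.id G) = CategoryTheory.CategoryStruct.id _ :=
  groupHomology.map_id ..

theorem homologyTwoMap_comp {G : Type} [Group G] (f h : G →* G) :
    homologyTwoMap (h.comp f) =
      CategoryTheory.CategoryStruct.comp (homologyTwoMap f) (homologyTwoMap h) :=
  groupHomology.map_comp f h (trivialResHom f) (trivialResHom h) 2

/-- `Aut⁺(Γ)`, the automorphisms of `Γ` induced by the maps `Σ → Σ` that preserve the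
orientation. For `g ≥ 1` the surface `Σ` is aspherical, so that every automorphism `σ` is induced by
a based map `f : Σ → Σ`, unique up to homotopy, `H₂(Σ; ℤ) = H₂(Γ; ℤ) ≅ ℤ` is generated by the
orientation class, and `f` acts on it by its degree `±1`: it preserves the orientation if and only
if `σ` acts as the identity on `H₂(Γ; ℤ)`. For `g = 0` the group `Γ` is trivial. -/
noncomputable def autPlus (g : ℕ) : Subgroup (MulAut (SurfaceGroup g)) where
  carrier := {σ | homologyTwoMap (MulEquiv.toMonoidHom σ) = CategoryTheory.CategoryStruct.id _}
  one_mem' := homologyTwoMap_id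
  mul_mem' := by
    intro σ τ hσ hτ
    have h := homologyTwoMap_comp (MulEquiv.toMonoidHom τ) (MulEquiv.toMonoidHom σ)
    rw [Set.mem_ofPred_eq] at hσ hτ
    rw [hσ, hτ, CategoryTheory.Category.comp_id] at h
    exact h
  inv_mem' := by
    intro σ hσ
    have h := homologyTwoMap_comp (MulEquiv.toMonoidHom σ) (MulEquiv.toMonoidHom σ⁻¹)
    rw [Set.mem_ofPred_eq] at hσ
    have h1 : (MulEquiv.toMonoidHom σ⁻¹).comp (MulEquiv.toMonoidHom σ) =
        MonoidHom.id (SurfaceGroup g) := by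
      ext x
      exact MulEquiv.symm_apply_apply σ _
    rw [h1, homologyTwoMap_id, hσ, CategoryTheory.Category.id_comp] at h
    exact h.symm

/-- The group `O₂(ℝ)`. -/
abbrev O2 : Type := Matrix.orthogonalGroup (Fin 2) ℝ

/-- The topology of pointwise convergence on `Hom(Γ, O₂(ℝ))`. -/
instance homTopology (g : ℕ) : TopologicalSpace (SurfaceGroup g →* O2) :=
  TopologicalSpace.induced (fun ρ => (ρ : SurfaceGroup g → O2)) inferInstance

/-- The orbit of `ρ` under the action of `Aut⁺(Γ)` by precomposition. -/
def autPlusOrbit {g : ℕ} (ρ : SurfaceGroup g →* O2) : Set (SurfaceGroup g →* O2) :=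
  {ρ' | ∃ σ ∈ autPlus g, ρ' = ρ.comp (MulEquiv.toMonoidHom σ)}

/-- The determinant of an orthogonal matrix. -/
noncomputable def detO2 : O2 →* ℝ where
  toFun A := (A : Matrix (Fin 2) (Fin 2) ℝ).det
  map_one' := Matrix.det_one
  map_mul' A B := Matrix.det_mul A.1 B.1

/-- `SO₂(ℝ)`, as a subgroup of `O₂(ℝ)`. -/
noncomputable abbrev SO2 : Subgroup O2 := detO2.ker

/-- The quotient homomorphism `ε : O₂(ℝ) → O₂(ℝ) / SO₂(ℝ)`. -/
noncomputable def epsO2 : O2 →* O2 ⧸ SO2 := QuotientGroup.mk' SO2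

/-- The group `PSL₂(ℂ)`. -/
abbrev PSL2C : Type := Matrix.ProjectiveSpecialLinearGroup (Fin 2) ℂ

/-- `0` if the representation `ρ` in `PSL₂(ℂ)` lifts to `SL₂(ℂ)`, and `1` otherwise. -/
noncomputable def sw {G : Type} [Group G] (ρ : G →* PSL2C) : Fin 2 :=
  open Classical in
  if ∃ ρ' : G →* Matrix.SpecialLinearGroup (Fin 2) ℂ,
    ∀ x, QuotientGroup.mk (ρ' x) = ρ x then 0 else 1

namespace O2

/-- The image `u = A 1` of the point `1` of the unit circle of `ℂ = ℝ²`. -/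
noncomputable def point (A : O2) : ℂ := ⟨A.1 0 0, A.1 1 0⟩

/-- A square root of `point A`. -/
noncomputable def root (A : O2) : ℂ := Complex.exp ((point A).arg / 2 * Complex.I)

theorem entries (A : O2) :
    A.1 0 0 ^ 2 + A.1 1 0 ^ 2 = 1 ∧
      ((A.1.det = 1 ∧ A.1 1 1 = A.1 0 0 ∧ A.1 0 1 = -A.1 1 0) ∨
        (A.1.det = -1 ∧ A.1 1 1 = -A.1 0 0 ∧ A.1 0 1 = A.1 1 0)) := by
  have h := (Matrix.mem_orthogonalGroup_iff' (Fin 2) ℝ).1 A.2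
  have h00 := congrFun (congrFun h 0) 0
  have h01 := congrFun (congrFun h 0) 1
  have h11 := congrFun (congrFun h 1) 1
  simp [Matrix.mul_apply, Fin.sum_univ_two] at h00 h01 h11
  rw [Matrix.det_fin_two]
  set a := A.1 0 0
  set b := A.1 0 1
  set c := A.1 1 0
  set d := A.1 1 1
  have hd : (a * d - b * c - 1) * (a * d - b * c + 1) = 0 := by grind
  refine ⟨by linarith, ?_⟩
  rcases mul_eq_zero.1 hd with h1 | h1
  · left
    refine ⟨by linarith, ?_, ?_⟩ <;> grind
  · right
    refine ⟨by linarith, ?_, ?_⟩ <;> grind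

theorem root_ne_zero (A : O2) : root A ≠ 0 := Complex.exp_ne_zero _

theorem root_sq (A : O2) : root A * root A = point A := by
  have hn : ‖point A‖ = 1 := by
    have h := (entries A).1
    rw [Complex.norm_def, Complex.normSq_apply]
    simp only [point]
    rw [show A.1 0 0 * A.1 0 0 + A.1 1 0 * A.1 1 0 = 1 by linarith, Real.sqrt_one]
  have h := Complex.norm_mul_exp_arg_mul_I (point A)
  rw [hn, Complex.ofReal_one, one_mul] at h
  rw [root, ← Complex.exp_add, ← add_mul, add_halves, h]

/-- A matrix in `SL₂(ℂ)` of the Möbius transformation that restricts to `A` on the unit circle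
of `ℂ = ℝ²`: with `u = A 1` this is `z ↦ u z` if `A` is a rotation and `z ↦ u / z` (which is
`u` times the conjugate of `z` on the circle) if `A` is a reflection. -/
noncomputable def toMatrix (A : O2) : Matrix (Fin 2) (Fin 2) ℂ :=
  open Classical in
  if A.1.det = 1 then !![root A, 0; 0, (root A)⁻¹]
  else !![0, -Complex.I * root A; -Complex.I * (root A)⁻¹, 0]

theorem det_toMatrix (A : O2) : (toMatrix A).det = 1 := by
  have h := root_ne_zero A
  have hI := Complex.I_mul_I
  unfold toMatrix
  split_ifs
  · rw [Matrix.det_fin_two_of]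
    field_simp
    ring
  · rw [Matrix.det_fin_two_of]
    field_simp
    linear_combination -hI

/-- The matrix `toMatrix A` as an element of `SL₂(ℂ)`. -/
noncomputable def toSL (A : O2) : Matrix.SpecialLinearGroup (Fin 2) ℂ :=
  ⟨toMatrix A, det_toMatrix A⟩

theorem mk_eq_mk {X Y : Matrix.SpecialLinearGroup (Fin 2) ℂ} (h : X.1 = Y.1 ∨ X.1 = -Y.1) :
    (QuotientGroup.mk X : PSL2C) = QuotientGroup.mk Y := by
  rcases h with h | h
  · rw [show X = Y from Subtype.ext h]
  · rw [show X = Y * (-1) from Subtype.ext (by simp [h])]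
    refine QuotientGroup.mk_mul_of_mem Y ?_
    rw [Subgroup.mem_center_iff]
    intro Z
    simp

theorem toMatrix_mul (A B : O2) :
    toMatrix (A * B) = toMatrix A * toMatrix B ∨ toMatrix (A * B) = -(toMatrix A * toMatrix B) := by
  have hA := root_sq A
  have hB := root_sq B
  have hAB := root_sq (A * B)
  have nA := root_ne_zero A
  have nB := root_ne_zero B
  have nAB := root_ne_zero (A * B)
  have hdet : (A * B).1.det = A.1.det * B.1.det := Matrix.det_mul A.1 B.1
  have e00 : (A * B).1 0 0 = A.1 0 0 * B.1 0 0 + A.1 0 1 * B.1 1 0 := by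
    simp [Matrix.mul_apply, Fin.sum_univ_two]
  have e10 : (A * B).1 1 0 = A.1 1 0 * B.1 0 0 + A.1 1 1 * B.1 1 0 := by
    simp [Matrix.mul_apply, Fin.sum_univ_two]
  have hI := Complex.I_mul_I
  obtain ⟨-, hA' | hA'⟩ := entries A
  · have hp : root (A * B) * root (A * B) = (root A * root B) * (root A * root B) := by
      rw [hAB, mul_mul_mul_comm, hA, hB]
      apply Complex.ext <;> simp [point, e00, e10, hA'.2.1, hA'.2.2] <;> ring
    have hr := mul_self_eq_mul_self_iff.1 hp
    obtain ⟨-, hB' | hB'⟩ := entries B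
    · have h1 : ¬ ((-1 : ℝ) = 1) := by norm_num
      simp only [toMatrix, hdet, hA'.1, hB'.1, mul_one, mul_neg, neg_neg, if_true, if_neg h1]
      rcases hr with hr | hr <;> rw [hr] <;> [left; right] <;> ext i j <;> fin_cases i <;>
        fin_cases j <;> simp <;> field_simp
    · have h1 : ¬ ((-1 : ℝ) = 1) := by norm_num
      simp only [toMatrix, hdet, hA'.1, hB'.1, mul_one, mul_neg, neg_neg, if_true, if_neg h1]
      rcases hr with hr | hr <;> rw [hr] <;> [left; right] <;> ext i j <;> fin_cases i <;>
        fin_cases j <;> simp <;> field_simp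
  · have hc : root B * root B * (⟨B.1 0 0, -B.1 1 0⟩ : ℂ) = 1 := by
      rw [hB]
      have := (entries B).1
      apply Complex.ext <;> simp [point] <;> linarith
    have hp : root (A * B) * root (A * B) = (root A * (root B)⁻¹) * (root A * (root B)⁻¹) := by
      have : point (A * B) = point A * ⟨B.1 0 0, -B.1 1 0⟩ := by
        apply Complex.ext <;> simp [point, e00, e10, hA'.2.1, hA'.2.2] <;> ring
      rw [hAB, this, mul_mul_mul_comm, hA, ← mul_inv, eq_inv_of_mul_eq_one_right hc]
    have hr := mul_self_eq_mul_self_iff.1 hp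
    obtain ⟨-, hB' | hB'⟩ := entries B
    · have h1 : ¬ ((-1 : ℝ) = 1) := by norm_num
      simp only [toMatrix, hdet, hA'.1, hB'.1, mul_one, mul_neg, neg_neg, if_true, if_neg h1]
      rcases hr with hr | hr <;> rw [hr] <;> [left; right] <;> ext i j <;> fin_cases i <;>
        fin_cases j <;> simp <;> field_simp
    · have h1 : ¬ ((-1 : ℝ) = 1) := by norm_num
      simp only [toMatrix, hdet, hA'.1, hB'.1, mul_one, mul_neg, neg_neg, if_true, if_neg h1]
      rcases hr with hr | hr <;> rw [hr] <;> [right; left] <;> ext i j <;> fin_cases i <;>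
        fin_cases j <;> simp <;> field_simp <;> simp [Complex.I_sq]

/-- The embedding of `O₂(ℝ)` in `PSL₂(ℂ)`: the Möbius transformation `toPSL A` restricts to `A`
on the unit circle. This is also the embedding `A ↦ diag(A, det A)` of `O₂(ℝ)` in
`SO₃(ℝ) = PSU₂`, acting on the sphere `ℂℙ¹`. -/
noncomputable def toPSL : O2 →* PSL2C :=
  MonoidHom.mk' (fun A => QuotientGroup.mk (toSL A)) fun A B => by
    rw [← QuotientGroup.mk_mul]
    exact mk_eq_mk (toMatrix_mul A B)

end O2

/-! ### Second homology of a one-relator group -/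

/-! The two invariants are preserved by automorphisms and locally constant on `Hom(Γ, O₂)`, so the
right-hand side is closed and contains the orbit (`isClosed_sameInvariants`).

For the other inclusion, a homomorphism is a tuple of `2g` matrices that satisfies the relation.
Automorphisms of the free group that preserve the relator up to conjugacy induce elements of
`Aut⁺(Γ)` (`homologyTwoMap_eq_id_of_isConj_relator`), so it is enough to study closed sets of tuples
invariant under Dehn twists and conjugations. Powers of a twist along a curve sent to a rotation of
infinite order multiply an entry by a dense subset of `SO₂`. Hence a handle of rotations, one of
them of infinite order, can be given arbitrary rotations, and twists along bridges spread this
freedom to the neighbouring handles (`mem_of_eq_below`). This settles the case of image in `SO₂`.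

Otherwise, twists acting on determinants lead to a normal form in which `b₁` is the only reflection
(`exists_reaches_isNormal`). The lifted relator is then governed by `a₁` alone: `a₁ = ±1`, and the
sign is the lifting obstruction (`IsNormal.obstruction_eq`). If the handles after the first had only
finite orders, the image would lie in a finite dihedral group; so one of them contains a rotation of
infinite order, and these handles become arbitrary. Conjugation by powers of such a rotation finally
moves `b₁` to any reflection (`mem_of_isNormal`). Two normal forms with equal sign are therefore in
each other's orbit closure. -/

theorem exists_primitive_on_freeGroup {α G A : Type*} [Group G] [AddCommGroup A]
    (p : FreeGroup α →* G) (c : G → G → A)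
    (hc : ∀ g h k, c h k - c (g * h) k + c g (h * k) - c g h = 0) :
    ∃ s : FreeGroup α → A, ∀ x y, c (p x) (p y) = s x + s y - s (x * y) := by
  have h1 (h : G) : c 1 h = c 1 1 := by
    have := hc 1 1 h
    simp only [one_mul] at this
    grind
  -- The central extension of `G` by `A` with cocycle `c`, normalised by `c 1 1` so that `(1, 0)` is
  -- the unit. Over a free group it splits, and the `A`-component of the lift `F` is a primitive up
  -- to sign and a constant.
  let _ : Mul (G × A) := ⟨fun x y => (x.1 * y.1, x.2 + y.2 + (c x.1 y.1 - c 1 1))⟩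
  let _ : One (G × A) := ⟨(1, 0)⟩
  let _ : Inv (G × A) := ⟨fun x => (x.1⁻¹, -x.2 - (c x.1⁻¹ x.1 - c 1 1))⟩
  have hmul (x y : G × A) : x * y = (x.1 * y.1, x.2 + y.2 + (c x.1 y.1 - c 1 1)) := rfl
  have hone : (1 : G × A) = (1, 0) := rfl
  have hinv (x : G × A) : x⁻¹ = (x.1⁻¹, -x.2 - (c x.1⁻¹ x.1 - c 1 1)) := rfl
  let _ : Group (G × A) := Group.ofLeftAxioms
    (by
      rintro ⟨g, a⟩ ⟨h, b⟩ ⟨k, d⟩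
      have := hc g h k
      simp only [hmul, Prod.mk.injEq, mul_assoc, true_and]
      grind)
    (by
      rintro ⟨g, a⟩
      simp [hmul, hone, h1])
    (by
      rintro ⟨g, a⟩
      simp only [hmul, hone, hinv, inv_mul_cancel, Prod.mk.injEq, true_and]
      abel)
  let F : FreeGroup α →* G × A := FreeGroup.lift fun a => (p (FreeGroup.of a), 0)
  let π : G × A →* G := MonoidHom.mk' Prod.fst fun _ _ => rfl
  have hF : π.comp F = p := FreeGroup.ext_hom _ _ fun a => by simp [F, π]
  have hF' (x) : (F x).1 = p x := DFunLike.congr_fun hF x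
  refine ⟨fun x => c 1 1 - (F x).2, fun x y => ?_⟩
  simp only [map_mul F, hmul, hF']
  abel

/-- On the kernel of the presentation, the primitive `s` of the pulled-back cocycle is additive up
to the constant `c 1 1` and invariant under conjugation in the free group. The kernel elements with
`s ∘ φ = s` thus form a normal subgroup `M`, which contains `r` and so is the whole kernel. Hence `s
∘ φ - s` descends to the quotient, where it is the required `t`. -/
theorem exists_primitive_of_isConj_relator {α A : Type*} [AddCommGroup A] (r : FreeGroup α)
    (c : PresentedGroup {r} → PresentedGroup {r} → A)
    (hc : ∀ g h k, c h k - c (g * h) k + c g (h * k) - c g h = 0)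
    (φ : FreeGroup α →* FreeGroup α) (hφ : IsConj r (φ r))
    (f : PresentedGroup {r} →* PresentedGroup {r})
    (hf : ∀ x, f (PresentedGroup.mk {r} x) = PresentedGroup.mk {r} (φ x)) :
    ∃ t : PresentedGroup {r} → A, ∀ g h, c (f g) (f h) - c g h = t g + t h - t (g * h) := by
  set p := PresentedGroup.mk {r} with hp
  have h1 (h) : c 1 h = c 1 1 := by
    have := hc 1 1 h
    simp only [one_mul] at this
    grind
  have h2 (h) : c h 1 = c 1 1 := by
    have := hc h 1 1
    simp only [mul_one] at this
    grind
  obtain ⟨s, hs⟩ := exists_primitive_on_freeGroup p c hc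
  have hl (x y) (hx : p x = 1) : s (x * y) = s x - c 1 1 + s y := by
    have := hs x y
    rw [hx, h1] at this
    rw [this]; abel
  have hr (x y) (hx : p x = 1) : s (y * x) = s x - c 1 1 + s y := by
    have := hs y x
    rw [hx, h2] at this
    rw [this]; abel
  have hconj (x w) (hx : p x = 1) : s (w * x * w⁻¹) = s x := by
    have h3 := hl (w * x * w⁻¹) w (by simp [hx])
    rw [inv_mul_cancel_right, hr x w hx] at h3
    grind
  have hs1 : s 1 = c 1 1 := by
    have := hs 1 1
    simp only [map_one, one_mul] at this
    grind
  have hpφ (x) (hx : p x = 1) : p (φ x) = 1 := by rw [← hf, hx, map_one]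
  let M : Subgroup (FreeGroup α) :=
    { carrier := {x | p x = 1 ∧ s (φ x) = s x}
      one_mem' := ⟨map_one _, by rw [map_one]⟩
      mul_mem' := by
        rintro x y ⟨hx, hx'⟩ ⟨hy, hy'⟩
        exact ⟨by rw [map_mul, hx, hy, one_mul],
          by rw [map_mul, hl _ _ (hpφ x hx), hl _ _ hx, hx', hy']⟩
      inv_mem' := by
        rintro x ⟨hx, hx'⟩
        refine ⟨by rw [map_inv, hx, inv_one], ?_⟩
        have h3 := hl x x⁻¹ hx
        have h4 := hl (φ x) (φ x)⁻¹ (hpφ x hx)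
        rw [mul_inv_cancel] at h3 h4
        rw [map_inv]
        grind }
  have hM : M.Normal := ⟨by
    rintro x ⟨hx, hx'⟩ w
    refine ⟨by simp [hx], ?_⟩
    rw [map_mul, map_mul, map_inv, hconj _ _ (hpφ x hx), hconj _ _ hx, hx']⟩
  have hrp : p r = 1 := PresentedGroup.one_of_mem rfl
  have hrM : r ∈ M := by
    obtain ⟨w, hw⟩ := isConj_iff.1 hφ
    exact ⟨hrp, by rw [← hw, hconj _ _ hrp]⟩
  have hle : Subgroup.normalClosure {r} ≤ M := Subgroup.normalClosure_le_normal (by simpa using hrM)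
  have hT (x y) (hxy : p x = p y) : s (φ x) - s x = s (φ y) - s y := by
    have hn : x⁻¹ * y ∈ M := hle (QuotientGroup.eq.1 hxy)
    have h3 := hr _ x hn.1
    have h4 := hr _ (φ x) (hpφ _ hn.1)
    rw [← map_mul] at h4
    rw [mul_inv_cancel_left] at h3 h4
    rw [h3, h4, hn.2]; abel
  choose q hq using PresentedGroup.mk_surjective {r}
  refine ⟨fun g => s (φ (q g)) - s (q g), fun g h => ?_⟩
  have h5 := hT (q (g * h)) (q g * q h) (by rw [map_mul]; simp only [hp, hq])
  have h6 := hs (q g) (q h)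
  have h7 := hs (φ (q g)) (φ (q h))
  rw [← hf, ← hf] at h7
  rw [map_mul] at h5
  simp only [hp, hq] at h6 h7
  simp only [h5, h6, h7]
  abel

open groupHomology in
theorem homologyTwoMap_eq_id {G : Type} [Group G] (f : G →* G)
    (h : ∀ z ∈ cycles₂ (Rep.trivial ℤ G ℤ),
      Finsupp.lmapDomain ℤ ℤ (Prod.map f f) z - z ∈ boundaries₂ (Rep.trivial ℤ G ℤ)) :
    homologyTwoMap f = CategoryTheory.CategoryStruct.id _ := by
  ext x
  induction x using H2_induction_on with
  | h z =>
    rw [homologyTwoMap, H2π_comp_map_apply]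
    refine (H2π_eq_iff _ _).2 ?_
    convert h z.1 z.2 using 2
    have h1 : (mapCycles₂ f (trivialResHom f) z).1 =
        (chainsMap₂ f (trivialResHom f)).hom z.1 := rfl
    rw [h1]
    exact Finsupp.mapRange_id _

open groupHomology in
/-- An endomorphism of a one-relator group that comes from an endomorphism of the free group which
maps the relator to a conjugate of itself acts trivially on the second homology. -/
theorem homologyTwoMap_eq_id_of_isConj_relator {α : Type} (r : FreeGroup α)
    (φ : FreeGroup α →* FreeGroup α) (hφ : IsConj r (φ r))
    (f : PresentedGroup {r} →* PresentedGroup {r})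
    (hf : ∀ x, f (PresentedGroup.mk {r} x) = PresentedGroup.mk {r} (φ x)) :
    homologyTwoMap f = CategoryTheory.CategoryStruct.id _ := by
  apply homologyTwoMap_eq_id
  set G := PresentedGroup {r}
  set B := boundaries₂ (Rep.trivial ℤ G ℤ) with hB
  -- The universal 2-cocycle, with values in chains modulo boundaries: the cocycle identity says
  -- that the boundary of a 3-chain vanishes there.
  let c (g h : G) : (G × G →₀ ℤ) ⧸ B := B.mkQ (Finsupp.single (g, h) 1)
  obtain ⟨t, ht⟩ := exists_primitive_of_isConj_relator r c (fun g h k => by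
    simp only [c, ← map_sub, ← map_add]
    refine (Submodule.Quotient.mk_eq_zero _).2 ⟨Finsupp.single (g, h, k) 1, ?_⟩
    erw [d₃₂_single]
    rfl) φ hφ f hf
  let T : (G →₀ ℤ) →ₗ[ℤ] (G × G →₀ ℤ) ⧸ B :=
    Finsupp.lsum ℤ fun g => LinearMap.toSpanSingleton ℤ _ (t g)
  -- Modulo boundaries, the difference between the chain map and the identity factors through the
  -- differential, so it kills cycles.
  have key : B.mkQ ∘ₗ (Finsupp.lmapDomain ℤ ℤ (Prod.map f f)) - B.mkQ =
      T ∘ₗ (d₂₁ (Rep.trivial ℤ G ℤ)).hom := by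
    refine Finsupp.lhom_ext' fun x => LinearMap.ext_ring ?_
    obtain ⟨g, h⟩ := x
    have h3 : (d₂₁ (Rep.trivial ℤ G ℤ)).hom (Finsupp.single (g, h) (1 : ℤ)) =
      Finsupp.single h (1 : ℤ) - Finsupp.single (g * h) (1 : ℤ) + Finsupp.single g (1 : ℤ) :=
        d₂₁_single (A := Rep.trivial ℤ G ℤ) (g, h) (1 : ℤ)
    have h4 := ht g h
    simp only [LinearMap.comp_apply, LinearMap.sub_apply, Finsupp.lsingle_apply]
    erw [h3]
    simp only [T, map_add, map_sub, Finsupp.lsum_single, LinearMap.toSpanSingleton_apply, one_smul,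
      Finsupp.lmapDomain_apply, Finsupp.mapDomain_single, Prod.map]
    refine h4.trans ?_
    abel
  intro z hz
  have h5 := LinearMap.congr_fun key z
  rw [LinearMap.comp_apply, show (d₂₁ (Rep.trivial ℤ G ℤ)).hom z = 0 from hz, map_zero] at h5
  rw [← Submodule.Quotient.mk_eq_zero]
  exact h5

/-! ### Automorphisms of the free group that preserve the surface relator -/

open scoped commutatorElement in
/-- The value of the surface relator on a tuple of group elements. -/
def relatorValue {G : Type*} [Group G] {g : ℕ} (v : Fin g ⊕ Fin g → G) : G :=
  (List.ofFn fun i : Fin g => ⁅v (Sum.inl i), v (Sum.inr i)⁆).prod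

theorem map_relatorValue {G H : Type*} [Group G] [Group H] {g : ℕ} (f : G →* H)
    (v : Fin g ⊕ Fin g → G) : f (relatorValue v) = relatorValue (f ∘ v) := by
  simp [relatorValue, map_list_prod, List.map_ofFn, Function.comp_def, map_commutatorElement]

theorem lift_surfaceRelator {G : Type*} [Group G] {g : ℕ} (v : Fin g ⊕ Fin g → G) :
    FreeGroup.lift v (surfaceRelator g) = relatorValue v := by
  refine (map_relatorValue (FreeGroup.lift v) FreeGroup.of).trans ?_
  simp [Function.comp_def]

/-- The values of a homomorphism at the standard generators. -/
def genTuple {g : ℕ} {G : Type*} [Group G] (ρ : SurfaceGroup g →* G) : Fin g ⊕ Fin g → G :=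
  fun s => ρ (PresentedGroup.of s)

theorem lift_genTuple {g : ℕ} {G : Type*} [Group G] (ρ : SurfaceGroup g →* G)
    (x : FreeGroup (Fin g ⊕ Fin g)) :
    FreeGroup.lift (genTuple ρ) x = ρ (PresentedGroup.mk _ x) := by
  have : FreeGroup.lift (genTuple ρ) = ρ.comp (PresentedGroup.mk _) :=
    FreeGroup.ext_hom _ _ fun s => by simp [genTuple]; rfl
  exact DFunLike.congr_fun this x

theorem relatorValue_genTuple {g : ℕ} {G : Type*} [Group G] (ρ : SurfaceGroup g →* G) :
    relatorValue (genTuple ρ) = 1 := by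
  rw [← lift_surfaceRelator, lift_genTuple,
    PresentedGroup.one_of_mem (Set.mem_singleton _), map_one]

theorem genTuple_injective {g : ℕ} {G : Type*} [Group G] :
    Function.Injective (genTuple : (SurfaceGroup g →* G) → Fin g ⊕ Fin g → G) :=
  fun _ _ h => PresentedGroup.ext fun s => congrFun h s

/-- The automorphisms of the free group that map the surface relator to a conjugate of itself. -/
def relatorAut (g : ℕ) : Subgroup (MulAut (FreeGroup (Fin g ⊕ Fin g))) where
  carrier := {φ | IsConj (surfaceRelator g) (φ (surfaceRelator g))}
  one_mem' := IsConj.refl _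
  mul_mem' {φ ψ} hφ hψ := IsConj.trans hφ (φ.toMonoidHom.map_isConj hψ)
  inv_mem' {φ} hφ := by
    have h := (φ⁻¹ : MulAut _).toMonoidHom.map_isConj hφ
    exact (show IsConj _ _ by simpa using h : IsConj (φ⁻¹ (surfaceRelator g)) _).symm

/-- Only this direction is needed: the automorphisms obtained in this way already have large enough
orbits. -/
theorem exists_mem_autPlus_of_mem_relatorAut {g : ℕ} {φ : MulAut (FreeGroup (Fin g ⊕ Fin g))}
    (hφ : φ ∈ relatorAut g) :
    ∃ σ ∈ autPlus g, ∀ x, σ (PresentedGroup.mk _ x) = PresentedGroup.mk _ (φ x) := by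
  have hker (ψ : MulAut (FreeGroup (Fin g ⊕ Fin g))) (hψ : ψ ∈ relatorAut g) :
      Subgroup.normalClosure {surfaceRelator g} ≤
        (Subgroup.normalClosure {surfaceRelator g}).comap ψ.toMonoidHom := by
    refine Subgroup.normalClosure_le_normal (Set.singleton_subset_iff.2 ?_)
    obtain ⟨w, hw⟩ := isConj_iff.1 hψ
    change ψ (surfaceRelator g) ∈ Subgroup.normalClosure _
    rw [← hw]
    exact Subgroup.normalClosure_normal.conj_mem _
      (Subgroup.subset_normalClosure (Set.mem_singleton _)) _
  let E (ψ : MulAut (FreeGroup (Fin g ⊕ Fin g))) (hψ : ψ ∈ relatorAut g) :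
      SurfaceGroup g →* SurfaceGroup g := QuotientGroup.map _ _ ψ.toMonoidHom (hker ψ hψ)
  have hE (ψ hψ x) : E ψ hψ (PresentedGroup.mk _ x) = PresentedGroup.mk _ (ψ x) := rfl
  let σ : MulAut (SurfaceGroup g) := MonoidHom.toMulEquiv (E φ hφ) (E φ⁻¹ (inv_mem hφ))
    (by
      refine MonoidHom.ext fun x => ?_
      obtain ⟨x, rfl⟩ := PresentedGroup.mk_surjective _ x
      simp [hE])
    (by
      refine MonoidHom.ext fun x => ?_
      obtain ⟨x, rfl⟩ := PresentedGroup.mk_surjective _ x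
      simp [hE])
  exact ⟨σ, homologyTwoMap_eq_id_of_isConj_relator _ φ.toMonoidHom hφ _ fun x => rfl, fun x => rfl⟩

theorem exists_mem_relatorAut {g : ℕ} (t t' : Fin g ⊕ Fin g → FreeGroup (Fin g ⊕ Fin g))
    (h : ∀ s, FreeGroup.lift t (t' s) = FreeGroup.of s)
    (h' : ∀ s, FreeGroup.lift t' (t s) = FreeGroup.of s)
    (hr : IsConj (relatorValue FreeGroup.of) (relatorValue t)) :
    ∃ φ ∈ relatorAut g, ∀ s, φ (FreeGroup.of s) = t s := by
  refine ⟨MonoidHom.toMulEquiv (FreeGroup.lift t) (FreeGroup.lift t')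
    (FreeGroup.ext_hom _ _ fun s => by simp [h']) (FreeGroup.ext_hom _ _ fun s => by simp [h]), ?_,
    fun s => by simp⟩
  change IsConj _ (FreeGroup.lift t (surfaceRelator g))
  rw [lift_surfaceRelator]
  exact hr

/-- The tuple obtained from `v` by precomposition with `φ`. -/
def tupleAct {G : Type*} [Group G] {g : ℕ} (φ : MulAut (FreeGroup (Fin g ⊕ Fin g)))
    (v : Fin g ⊕ Fin g → G) : Fin g ⊕ Fin g → G :=
  fun s => FreeGroup.lift v (φ (FreeGroup.of s))

theorem lift_tupleAct {G : Type*} [Group G] {g : ℕ} (φ : MulAut (FreeGroup (Fin g ⊕ Fin g)))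
    (v : Fin g ⊕ Fin g → G) (x : FreeGroup (Fin g ⊕ Fin g)) :
    FreeGroup.lift (tupleAct φ v) x = FreeGroup.lift v (φ x) := by
  have : FreeGroup.lift (tupleAct φ v) = (FreeGroup.lift v).comp φ.toMonoidHom :=
    FreeGroup.ext_hom _ _ fun s => by simp [tupleAct]
  exact DFunLike.congr_fun this x

/-- Precomposition is a right action, whence the reversed order. -/
theorem tupleAct_mul {G : Type*} [Group G] {g : ℕ} (φ ψ : MulAut (FreeGroup (Fin g ⊕ Fin g)))
    (v : Fin g ⊕ Fin g → G) : tupleAct (φ * ψ) v = tupleAct ψ (tupleAct φ v) := by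
  funext s
  simp only [tupleAct]
  exact (lift_tupleAct φ v _).symm

theorem tupleAct_one {G : Type*} [Group G] {g : ℕ} (v : Fin g ⊕ Fin g → G) :
    tupleAct 1 v = v := by
  funext s
  simp [tupleAct]

/-! ### Twists -/

section Twists

open Function

variable {G H : Type*} [Group G] [Group H] {g : ℕ}

/-- `b_i ↦ b_i a_i ^ n`. -/
def twistRight (i : Fin g) (n : ℤ) (v : Fin g ⊕ Fin g → G) : Fin g ⊕ Fin g → G :=
  update v (Sum.inr i) (v (Sum.inr i) * v (Sum.inl i) ^ n)

/-- `a_i ↦ a_i b_i ^ n`. -/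
def twistLeft (i : Fin g) (n : ℤ) (v : Fin g ⊕ Fin g → G) : Fin g ⊕ Fin g → G :=
  update v (Sum.inl i) (v (Sum.inl i) * v (Sum.inr i) ^ n)

/-- The class of a simple closed curve that crosses the handles `i` and `j`. -/
def bridge (i j : Fin g) (v : Fin g ⊕ Fin g → G) : G :=
  (v (Sum.inr i))⁻¹ * (v (Sum.inl j) * v (Sum.inr j) * (v (Sum.inl j))⁻¹)

/-- The `n`-th power of the twist along `bridge i j`. -/
def twistBridge (i j : Fin g) (n : ℤ) (v : Fin g ⊕ Fin g → G) : Fin g ⊕ Fin g → G :=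
  update (update (update v (Sum.inl i) (v (Sum.inl i) * bridge i j v ^ (-n)))
    (Sum.inr i) (bridge i j v ^ n * v (Sum.inr i) * bridge i j v ^ (-n)))
    (Sum.inl j) (bridge i j v ^ n * v (Sum.inl j))

theorem comp_twistRight (f : G →* H) (i : Fin g) (n : ℤ) (v : Fin g ⊕ Fin g → G) :
    f ∘ twistRight i n v = twistRight i n (f ∘ v) := by
  simp [twistRight, comp_update]

theorem comp_twistLeft (f : G →* H) (i : Fin g) (n : ℤ) (v : Fin g ⊕ Fin g → G) :
    f ∘ twistLeft i n v = twistLeft i n (f ∘ v) := by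
  simp [twistLeft, comp_update]

theorem map_bridge (f : G →* H) (i j : Fin g) (v : Fin g ⊕ Fin g → G) :
    f (bridge i j v) = bridge i j (f ∘ v) := by
  simp [bridge]

theorem comp_twistBridge (f : G →* H) (i j : Fin g) (n : ℤ) (v : Fin g ⊕ Fin g → G) :
    f ∘ twistBridge i j n v = twistBridge i j n (f ∘ v) := by
  simp only [twistBridge, comp_update, map_mul, map_zpow, map_bridge, comp_apply]

theorem twistRight_neg (i : Fin g) (n : ℤ) (v : Fin g ⊕ Fin g → G) :
    twistRight i (-n) (twistRight i n v) = v := by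
  simp [twistRight]

theorem twistLeft_neg (i : Fin g) (n : ℤ) (v : Fin g ⊕ Fin g → G) :
    twistLeft i (-n) (twistLeft i n v) = v := by
  simp [twistLeft]

/-- With `c` the bridge, the twist conjugates both `b_i` and `a_j b_j a_j⁻¹` by `c ^ n`, hence also
`c`, which commutes with its own power. This makes the twists with exponents `n` and `-n` inverse to
each other. -/
theorem bridge_twistBridge {i j : Fin g} (hij : i ≠ j) (n : ℤ) (v : Fin g ⊕ Fin g → G) :
    bridge i j (twistBridge i j n v) = bridge i j v := by
  have h (c x y : G) (hc : c = x⁻¹ * y) :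
      (c ^ n * x * c ^ (-n))⁻¹ * (c ^ n * y * (c ^ n)⁻¹) = c := by
    have : (c ^ n * x * c ^ (-n))⁻¹ * (c ^ n * y * (c ^ n)⁻¹) = c ^ n * (x⁻¹ * y) * (c ^ n)⁻¹ := by
      rw [zpow_neg]; group
    rw [this, ← hc]; group
  have := h (bridge i j v) _ _ rfl
  rw [← this]
  simp only [bridge, twistBridge, update_self, update_of_ne, ne_eq, reduceCtorEq,
    not_false_eq_true, Sum.inr.injEq, hij.symm]
  group

theorem twistBridge_neg {i j : Fin g} (hij : i ≠ j) (n : ℤ) (v : Fin g ⊕ Fin g → G) :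
    twistBridge i j (-n) (twistBridge i j n v) = v := by
  rw [twistBridge, bridge_twistBridge hij]
  funext s
  rcases s with k | k
  · by_cases hk : k = j
    · subst hk
      simp [twistBridge]
    · by_cases hk' : k = i
      · subst hk'
        simp [twistBridge, hk]
      · simp [twistBridge, hk, hk']
  · by_cases hk' : k = i
    · subst hk'
      simp [twistBridge]
      group
    · simp [twistBridge, hk']

theorem relatorValue_twistRight (i : Fin g) (n : ℤ) (v : Fin g ⊕ Fin g → G) :
    relatorValue (twistRight i n v) = relatorValue v := by
  refine congrArg (fun f => (List.ofFn f).prod) (funext fun k => ?_)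
  by_cases hk : k = i
  · subst hk
    simp only [twistRight, update_self, update_of_ne, ne_eq, reduceCtorEq, not_false_eq_true,
      commutatorElement_def]
    group
  · simp [twistRight, hk]

theorem relatorValue_twistLeft (i : Fin g) (n : ℤ) (v : Fin g ⊕ Fin g → G) :
    relatorValue (twistLeft i n v) = relatorValue v := by
  refine congrArg (fun f => (List.ofFn f).prod) (funext fun k => ?_)
  by_cases hk : k = i
  · subst hk
    simp only [twistLeft, update_self, update_of_ne, ne_eq, reduceCtorEq, not_false_eq_true,
      commutatorElement_def]
    group
  · simp [twistLeft, hk]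

theorem prod_ofFn_eq_of_adjacent {M : Type*} [Monoid M] :
    ∀ {g : ℕ} (f f' : Fin g → M) (i j : Fin g), j.val = i.val + 1 →
      (∀ k, k ≠ i → k ≠ j → f' k = f k) → f' i * f' j = f i * f j →
      (List.ofFn f').prod = (List.ofFn f).prod
  | 0, _, _, i, _, _, _, _ => i.elim0
  | 1, _, _, i, j, h, _, _ => by omega
  | g + 2, f, f', i, j, hij, h, hp => by
    induction i using Fin.cases with
    | zero =>
      obtain rfl : j = Fin.succ 0 := Fin.ext hij
      have htail : (fun k : Fin g => f' k.succ.succ) = fun k : Fin g => f k.succ.succ :=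
        funext fun k => h _ (Fin.succ_ne_zero _) fun h0 => by simp [Fin.ext_iff] at h0
      rw [List.ofFn_succ, List.ofFn_succ, List.ofFn_succ, List.ofFn_succ, htail]
      simp only [List.prod_cons, ← mul_assoc, hp]
    | succ i =>
      induction j using Fin.cases with
      | zero => simp at hij
      | succ j =>
        rw [List.ofFn_succ (f := f), List.ofFn_succ (f := f'), List.prod_cons, List.prod_cons,
          h 0 (Fin.succ_ne_zero _).symm (Fin.succ_ne_zero _).symm]
        congr 1
        exact prod_ofFn_eq_of_adjacent _ _ i j (by simpa using hij)
          (fun k hk hk' => h _ (by simpa using hk) (by simpa using hk')) hp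

/-- The product of the two commutators is `(a_i b_i a_i⁻¹) c b_j⁻¹` with `c` the bridge, and the
twist fixes each of the three factors. -/
theorem relatorValue_twistBridge {i j : Fin g} (hij : j.val = i.val + 1) (n : ℤ)
    (v : Fin g ⊕ Fin g → G) : relatorValue (twistBridge i j n v) = relatorValue v := by
  have hne : i ≠ j := by rintro rfl; omega
  refine prod_ofFn_eq_of_adjacent _ _ i j hij (fun k hi hj => by simp [twistBridge, hi, hj]) ?_
  have h (c a x y z : G) (hc : c = x⁻¹ * (y * z * y⁻¹)) :
      a * c ^ (-n) * (c ^ n * x * c ^ (-n)) * (a * c ^ (-n))⁻¹ * (c ^ n * x * c ^ (-n))⁻¹ *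
        (c ^ n * y * z * (c ^ n * y)⁻¹ * z⁻¹) = a * x * a⁻¹ * x⁻¹ * (y * z * y⁻¹ * z⁻¹) := by
    have : a * c ^ (-n) * (c ^ n * x * c ^ (-n)) * (a * c ^ (-n))⁻¹ * (c ^ n * x * c ^ (-n))⁻¹ *
        (c ^ n * y * z * (c ^ n * y)⁻¹ * z⁻¹) =
        a * x * a⁻¹ * (c ^ n * (x⁻¹ * (y * z * y⁻¹)) * (c ^ n)⁻¹) * z⁻¹ := by
      group
    rw [this, ← hc, (Commute.zpow_self c n).eq, mul_inv_cancel_right, hc]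
    group
  simp only [twistBridge, update_self, update_of_ne, ne_eq, reduceCtorEq, not_false_eq_true,
    Sum.inl.injEq, Sum.inr.injEq, hne, hne.symm, commutatorElement_def]
  exact h (bridge i j v) _ _ _ _ rfl

/-- A Yoneda argument: a natural operation on tuples is determined by its value on the free
generators, which is the tuple of images under `φ`. -/
theorem exists_tupleAct_of_natural
    (T T' : ∀ {G : Type} [Group G], (Fin g ⊕ Fin g → G) → Fin g ⊕ Fin g → G)
    (hT : ∀ {G H : Type} [Group G] [Group H] (f : G →* H) (v : Fin g ⊕ Fin g → G),
      f ∘ T v = T (f ∘ v))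
    (hT' : ∀ {G H : Type} [Group G] [Group H] (f : G →* H) (v : Fin g ⊕ Fin g → G),
      f ∘ T' v = T' (f ∘ v))
    (h : ∀ {G : Type} [Group G] (v : Fin g ⊕ Fin g → G), T (T' v) = v)
    (h' : ∀ {G : Type} [Group G] (v : Fin g ⊕ Fin g → G), T' (T v) = v)
    (hr : ∀ {G : Type} [Group G] (v : Fin g ⊕ Fin g → G), relatorValue (T v) = relatorValue v)
    {G : Type} [Group G] :
    ∃ φ ∈ relatorAut g, ∀ v : Fin g ⊕ Fin g → G, tupleAct φ v = T v := by
  have hof {G : Type} [Group G] (w : Fin g ⊕ Fin g → G) :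
      FreeGroup.lift w ∘ FreeGroup.of = w := by
    funext s
    simp
  obtain ⟨φ, hφ, hφt⟩ := exists_mem_relatorAut (T FreeGroup.of) (T' FreeGroup.of)
    (fun s => congrFun ((hT' _ _).trans (by rw [hof, h'])) s)
    (fun s => congrFun ((hT _ _).trans (by rw [hof, h])) s)
    (by rw [hr])
  refine ⟨φ, hφ, fun v => ?_⟩
  funext s
  simp only [tupleAct, hφt]
  exact congrFun ((hT (FreeGroup.lift v) FreeGroup.of).trans (by rw [hof])) s

end Twists

/-! ### Twists and conjugations realised by relator-preserving automorphisms. -/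

section Moves

variable {G : Type} [Group G] {g : ℕ}

theorem exists_tupleAct_eq_twistRight (i : Fin g) (n : ℤ) :
    ∃ φ ∈ relatorAut g, ∀ v : Fin g ⊕ Fin g → G, tupleAct φ v = twistRight i n v :=
  exists_tupleAct_of_natural (twistRight i n) (twistRight i (-n))
    (fun f v => comp_twistRight f i n v)
    (fun f v => comp_twistRight f i _ v)
    (fun v => by simpa using twistRight_neg i (-n) v) (fun v => twistRight_neg i n v)
    (fun v => relatorValue_twistRight i n v)

theorem exists_tupleAct_eq_twistLeft (i : Fin g) (n : ℤ) :
    ∃ φ ∈ relatorAut g, ∀ v : Fin g ⊕ Fin g → G, tupleAct φ v = twistLeft i n v :=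
  exists_tupleAct_of_natural (twistLeft i n) (twistLeft i (-n)) (fun f v => comp_twistLeft f i n v)
    (fun f v => comp_twistLeft f i _ v)
    (fun v => by simpa using twistLeft_neg i (-n) v) (fun v => twistLeft_neg i n v)
    (fun v => relatorValue_twistLeft i n v)

theorem exists_tupleAct_eq_twistBridge {i j : Fin g} (hij : j.val = i.val + 1) (n : ℤ) :
    ∃ φ ∈ relatorAut g, ∀ v : Fin g ⊕ Fin g → G, tupleAct φ v = twistBridge i j n v := by
  have hne : i ≠ j := by rintro rfl; omega
  exact exists_tupleAct_of_natural (twistBridge i j n) (twistBridge i j (-n))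
    (fun f v => comp_twistBridge f i j n v) (fun f v => comp_twistBridge f i j _ v)
    (fun v => by simpa using twistBridge_neg hne (-n) v) (fun v => twistBridge_neg hne n v)
    (fun v => relatorValue_twistBridge hij n v)

theorem exists_tupleAct_eq_conj (w : FreeGroup (Fin g ⊕ Fin g)) :
    ∃ φ ∈ relatorAut g, ∀ (v : Fin g ⊕ Fin g → G) (s),
      tupleAct φ v s = FreeGroup.lift v w * v s * (FreeGroup.lift v w)⁻¹ :=
  ⟨MulAut.conj w, isConj_iff.2 ⟨w, rfl⟩, fun v s => by simp [tupleAct]⟩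

end Moves

/-! ### The group `O₂(ℝ)` -/

namespace O2

theorem det_eq (A : O2) : detO2 A = 1 ∨ detO2 A = -1 := by
  rcases (entries A).2 with h | h
  exacts [Or.inl h.1, Or.inr h.1]

theorem det_ne_one {A : O2} : detO2 A ≠ 1 ↔ detO2 A = -1 := by
  rcases det_eq A with h | h <;> rw [h] <;> norm_num

/-- The rotation of angle `θ`. -/
noncomputable def rot (θ : Real.Angle) : O2 :=
  ⟨!![θ.cos, -θ.sin; θ.sin, θ.cos], by
    rw [Matrix.mem_orthogonalGroup_iff]
    have h := Real.Angle.cos_sq_add_sin_sq θ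
    ext i j
    fin_cases i <;> fin_cases j <;> simp [Matrix.mul_apply, Fin.sum_univ_two] <;> linarith⟩

theorem rot_add (θ η : Real.Angle) : rot (θ + η) = rot θ * rot η := by
  apply Subtype.ext
  change !![_, _; _, _] = !![_, _; _, _] * !![_, _; _, _]
  rw [Real.Angle.cos_add, Real.Angle.sin_add]
  ext i j
  fin_cases i <;> fin_cases j <;> simp <;> ring

/-- Rotations, as a homomorphism. -/
noncomputable def rotHom : Multiplicative Real.Angle →* O2 :=
  MonoidHom.mk' (fun θ => rot θ.toAdd) fun θ η => rot_add θ.toAdd η.toAdd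

theorem rot_zsmul (n : ℤ) (θ : Real.Angle) : rot (n • θ) = rot θ ^ n :=
  map_zpow rotHom (Multiplicative.ofAdd θ) n

theorem rot_zero : rot 0 = 1 := map_one rotHom

theorem det_rot (θ : Real.Angle) : detO2 (rot θ) = 1 := by
  change Matrix.det !![_, _; _, _] = _
  have h := Real.Angle.cos_sq_add_sin_sq θ
  rw [Matrix.det_fin_two_of]
  linarith

theorem continuous_rot : Continuous rot := by
  refine Continuous.subtype_mk (continuous_matrix fun i j => ?_) _
  have hs := Real.Angle.continuous_sin.neg
  fin_cases i <;> fin_cases j <;> simp [Real.Angle.continuous_cos, Real.Angle.continuous_sin]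
  exact hs

theorem rot_injective : Function.Injective rot := by
  intro θ η h
  have h0 := congrFun (congrFun (congrArg Subtype.val h) 0) 0
  have h1 := congrFun (congrFun (congrArg Subtype.val h) 1) 0
  simp only [rot, Matrix.of_apply, Matrix.cons_val', Matrix.cons_val_zero, Matrix.cons_val_fin_one,
    Matrix.cons_val_one] at h0 h1
  induction θ using Real.Angle.induction_on
  induction η using Real.Angle.induction_on
  exact Real.Angle.cos_sin_inj h0 h1

theorem exists_rot_eq {A : O2} (hA : detO2 A = 1) : ∃ θ, rot θ = A := by
  obtain ⟨h, h' | h'⟩ := entries A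
  · have hn : ‖(⟨A.1 0 0, A.1 1 0⟩ : ℂ)‖ = 1 := by
      rw [Complex.norm_def, Complex.normSq_mk, Real.sqrt_eq_one]
      linarith
    have h0 : (⟨A.1 0 0, A.1 1 0⟩ : ℂ) ≠ 0 := by
      intro h0
      rw [h0] at hn
      simp at hn
    refine ⟨(Complex.arg ⟨A.1 0 0, A.1 1 0⟩ : ℝ), Subtype.ext ?_⟩
    have hc := Complex.cos_arg h0
    have hs := Complex.sin_arg (⟨A.1 0 0, A.1 1 0⟩ : ℂ)
    rw [hn, div_one] at hc hs
    simp only [rot, Real.Angle.cos_coe, Real.Angle.sin_coe, hc, hs]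
    ext i j
    fin_cases i <;> fin_cases j <;> simp [h'.2.1, h'.2.2]
  · have := h'.1
    change detO2 A = -1 at this
    rw [hA] at this
    norm_num at this

theorem commute_of_det {A B : O2} (hA : detO2 A = 1) (hB : detO2 B = 1) : Commute A B := by
  obtain ⟨θ, rfl⟩ := exists_rot_eq hA
  obtain ⟨η, rfl⟩ := exists_rot_eq hB
  rw [commute_iff_eq, ← rot_add, ← rot_add, add_comm]

theorem mul_self_of_det {S : O2} (hS : detO2 S = -1) : S * S = 1 := by
  obtain ⟨h, h' | h'⟩ := entries S
  · have := h'.1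
    change detO2 S = 1 at this
    rw [hS] at this
    norm_num at this
  · apply Subtype.ext
    change S.1 * S.1 = 1
    ext i j
    fin_cases i <;> fin_cases j <;>
      simp [Matrix.mul_apply, Fin.sum_univ_two, h'.2.1, h'.2.2] <;> linarith

theorem conj_eq_inv {A S : O2} (hA : detO2 A = 1) (hS : detO2 S = -1) : S * A = A⁻¹ * S := by
  have h := inv_eq_of_mul_eq_one_right
    (mul_self_of_det (S := S * A) (by rw [map_mul, hA, hS, mul_one]))
  rw [← h, mul_inv_rev, inv_eq_of_mul_eq_one_right (mul_self_of_det hS)]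

theorem mem_closure_zpow {A B : O2} (hA : detO2 A = 1) (hA' : ¬ IsOfFinOrder A)
    (hB : detO2 B = 1) : B ∈ closure (Set.range fun n : ℤ => A ^ n) := by
  obtain ⟨θ, rfl⟩ := exists_rot_eq hA
  obtain ⟨η, rfl⟩ := exists_rot_eq hB
  have hθ : addOrderOf θ = 0 := by
    rw [addOrderOf_eq_zero_iff]
    intro h
    exact hA' (MonoidHom.isOfFinOrder rotHom (isOfFinOrder_ofAdd_iff.2 h))
  have : Fact (0 < 2 * Real.pi) := ⟨Real.two_pi_pos⟩
  have hd : DenseRange (fun n : ℤ => n • θ) :=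
    (AddCircle.denseRange_zsmul_iff (p := 2 * Real.pi) (a := θ)).2 hθ
  have h1 := image_closure_subset_closure_image continuous_rot ⟨η, hd η, rfl⟩
  rw [← Set.range_comp] at h1
  simpa only [Function.comp_def, rot_zsmul] using h1

/-- These are the rotations whose angle is an irrational multiple of `2π`. They serve as generic
values: a closed condition need only be checked on them. -/
theorem mem_closure_not_isOfFinOrder {B : O2} (hB : detO2 B = 1) :
    B ∈ closure {A : O2 | detO2 A = 1 ∧ ¬ IsOfFinOrder A} := by
  obtain ⟨η, rfl⟩ := exists_rot_eq hB
  induction η using Real.Angle.induction_on with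
  | _ x =>
  have hc : Continuous fun y : ℝ => rot ((2 * Real.pi * y : ℝ) : Real.Angle) :=
    continuous_rot.comp (Real.Angle.continuous_coe.comp (by fun_prop))
  have h1 := image_closure_subset_closure_image hc ⟨x / (2 * Real.pi), dense_irrational _, rfl⟩
  simp only [mul_div_cancel₀ x Real.two_pi_pos.ne'] at h1
  refine closure_mono ?_ h1
  rintro _ ⟨y, hy, rfl⟩
  refine ⟨det_rot _, fun h => ?_⟩
  obtain ⟨n, hn, h⟩ := isOfFinOrder_iff_pow_eq_one.1 h
  rw [← zpow_natCast, ← rot_zsmul, ← rot_zero] at h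
  have h2 := rot_injective h
  have : Fact (0 < 2 * Real.pi) := ⟨Real.two_pi_pos⟩
  have h3 : IsOfFinAddOrder ((2 * Real.pi * y : ℝ) : AddCircle (2 * Real.pi)) :=
    isOfFinAddOrder_iff_nsmul_eq_zero.2 ⟨n, hn, by simpa using! h2⟩
  obtain ⟨q, hq⟩ := AddCircle.isOfFinAddOrder_iff_exists_rat_eq_div.1 h3
  exact hy ⟨q, by rw [hq, mul_div_cancel_left₀ _ Real.two_pi_pos.ne']⟩

theorem finite_torsion {N : ℕ} (hN : 0 < N) : {A : O2 | detO2 A = 1 ∧ A ^ N = 1}.Finite := by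
  have : Fact (0 < 2 * Real.pi) := ⟨Real.two_pi_pos⟩
  refine ((AddCircle.finite_torsion (2 * Real.pi) hN).image rot).subset ?_
  rintro A ⟨hA, hA'⟩
  obtain ⟨θ, rfl⟩ := exists_rot_eq hA
  refine ⟨θ, ?_, rfl⟩
  rw [← zpow_natCast, ← rot_zsmul, ← rot_zero] at hA'
  simpa using! rot_injective hA'

/-- The group generated by the rotations of order dividing `N` and the reflection `S`. -/
noncomputable def dihedral (N : ℕ) (S : O2) (hS : detO2 S = -1) : Subgroup O2 where
  carrier := {A | detO2 A = 1 ∧ A ^ N = 1 ∨ detO2 A = -1 ∧ (A * S) ^ N = 1}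
  one_mem' := by simp
  mul_mem' := by
    have hS2 := mul_self_of_det hS
    rintro A B (⟨hA, hA'⟩ | ⟨hA, hA'⟩) (⟨hB, hB'⟩ | ⟨hB, hB'⟩)
    · exact Or.inl ⟨by simp [hA, hB], by rw [(commute_of_det hA hB).mul_pow, hA', hB', one_mul]⟩
    · refine Or.inr ⟨by simp [hA, hB], ?_⟩
      rw [mul_assoc, (commute_of_det hA (by simp [hB, hS])).mul_pow, hA', hB', one_mul]
    · refine Or.inr ⟨by simp [hA, hB], ?_⟩
      rw [conj_eq_inv hB hA, mul_assoc, (commute_of_det (by simp [hB]) (by simp [hA, hS])).mul_pow,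
        hA', inv_pow, hB', inv_one, one_mul]
    · refine Or.inl ⟨by simp [hA, hB], ?_⟩
      have h1 : A * B = A * S * (B * S)⁻¹ := by
        rw [mul_inv_rev, mul_assoc, mul_inv_cancel_left,
          inv_eq_of_mul_eq_one_right (mul_self_of_det hB)]
      rw [h1, (commute_of_det (by simp [hA, hS]) (by simp [hB, hS])).mul_pow, hA', inv_pow, hB',
        inv_one, one_mul]
  inv_mem' := by
    rintro A (⟨hA, hA'⟩ | ⟨hA, hA'⟩)
    · exact Or.inl ⟨by simp [hA], by rw [inv_pow, hA', inv_one]⟩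
    · rw [inv_eq_of_mul_eq_one_right (mul_self_of_det hA)]
      exact Or.inr ⟨hA, hA'⟩

theorem finite_dihedral {N : ℕ} (hN : 0 < N) {S : O2} (hS : detO2 S = -1) :
    (dihedral N S hS : Set O2).Finite := by
  refine ((finite_torsion hN).union ((finite_torsion hN).image (· * S⁻¹))).subset ?_
  rintro A (hA | ⟨hA, hA'⟩)
  · exact Or.inl hA
  · exact Or.inr ⟨A * S, ⟨by simp [hA, hS], hA'⟩, by simp⟩

/-- Otherwise all these rotations have order dividing a common `N`, and the image lies in the finite
group `dihedral N S hS`. The reflection `S` is free to choose; taking it among the generators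
excludes that generator from the conclusion. -/
theorem exists_not_isOfFinOrder_of_infinite {ι : Type*} [Finite ι] (v : ι → O2) {S : O2}
    (hS : detO2 S = -1) (h : (Set.range (FreeGroup.lift v)).Infinite) :
    ∃ s, (detO2 (v s) = 1 ∧ ¬ IsOfFinOrder (v s)) ∨
      (detO2 (v s) = -1 ∧ ¬ IsOfFinOrder (v s * S)) := by
  by_contra! hcon
  cases nonempty_fintype ι
  let x (s : ι) : O2 := if detO2 (v s) = 1 then v s else v s * S
  have hx (s) : IsOfFinOrder (x s) := by
    by_cases hs : detO2 (v s) = 1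
    · simp only [x, if_pos hs]
      exact (hcon s).1 hs
    · simp only [x, if_neg hs]
      exact (hcon s).2 (det_ne_one.1 hs)
  have hN : 0 < ∏ s, orderOf (x s) := Finset.prod_pos fun s _ => (hx s).orderOf_pos
  have hxN (s) : x s ^ (∏ s, orderOf (x s)) = 1 :=
    orderOf_dvd_iff_pow_eq_one.1 (Finset.dvd_prod_of_mem _ (Finset.mem_univ s))
  refine h ((finite_dihedral hN hS).subset ?_)
  have hle : (FreeGroup.lift v).range ≤ dihedral (∏ s, orderOf (x s)) S hS := by
    refine FreeGroup.range_lift_le ?_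
    rintro _ ⟨s, rfl⟩
    have := hxN s
    by_cases hs : detO2 (v s) = 1
    · simp only [x, if_pos hs] at this
      exact Or.inl ⟨hs, this⟩
    · simp only [x, if_neg hs] at this
      exact Or.inr ⟨det_ne_one.1 hs, this⟩
  exact hle

theorem exists_det_eq_neg_one : ∃ S : O2, detO2 S = -1 := by
  refine ⟨⟨!![1, 0; 0, -1], ?_⟩, ?_⟩
  · rw [Matrix.mem_orthogonalGroup_iff]
    ext i j
    fin_cases i <;> fin_cases j <;> simp [Matrix.mul_apply, Fin.sum_univ_two]
  · change Matrix.det !![_, _; _, _] = _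
    simp [Matrix.det_fin_two_of]

end O2

/-! ### Closed sets of tuples that are invariant under twists -/

open Function

section SetHandle

variable {G : Type*} {g : ℕ}

/-- Replace the two entries of `v` at the handle `i`. -/
def setHandle (v : Fin g ⊕ Fin g → G) (i : Fin g) (A B : G) : Fin g ⊕ Fin g → G :=
  update (update v (Sum.inl i) A) (Sum.inr i) B

@[simp] theorem setHandle_inl (v : Fin g ⊕ Fin g → G) (i : Fin g) (A B : G) :
    setHandle v i A B (Sum.inl i) = A := by simp [setHandle]

@[simp] theorem setHandle_inr (v : Fin g ⊕ Fin g → G) (i : Fin g) (A B : G) :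
    setHandle v i A B (Sum.inr i) = B := by simp [setHandle]

theorem setHandle_inl_of_ne (v : Fin g ⊕ Fin g → G) {i k : Fin g} (h : k ≠ i) (A B : G) :
    setHandle v i A B (Sum.inl k) = v (Sum.inl k) := by simp [setHandle, h]

theorem setHandle_inr_of_ne (v : Fin g ⊕ Fin g → G) {i k : Fin g} (h : k ≠ i) (A B : G) :
    setHandle v i A B (Sum.inr k) = v (Sum.inr k) := by simp [setHandle, h]

@[simp] theorem update_inr_setHandle (v : Fin g ⊕ Fin g → G) (i : Fin g) (A B B' : G) :
    update (setHandle v i A B) (Sum.inr i) B' = setHandle v i A B' := by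
  simp [setHandle]

@[simp] theorem update_inl_setHandle (v : Fin g ⊕ Fin g → G) (i : Fin g) (A B A' : G) :
    update (setHandle v i A B) (Sum.inl i) A' = setHandle v i A' B := by
  simp only [setHandle]
  rw [update_comm (a := Sum.inr i) (b := Sum.inl i) (by simp), update_idem]

theorem setHandle_self (v : Fin g ⊕ Fin g → G) (i : Fin g) :
    setHandle v i (v (Sum.inl i)) (v (Sum.inr i)) = v := by
  simp [setHandle]

theorem Continuous.setHandle [TopologicalSpace G] {X : Type*} [TopologicalSpace X]
    {f : X → Fin g ⊕ Fin g → G} (hf : Continuous f) (i : Fin g) {a b : X → G} (ha : Continuous a)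
    (hb : Continuous b) : Continuous fun x => setHandle (f x) i (a x) (b x) :=
  (hf.update _ ha).update _ hb

end SetHandle

/-! ### Moving handles of rotations inside a closed invariant set. -/

section Density

variable {g : ℕ} {K : Set (Fin g ⊕ Fin g → O2)}

theorem IsClosed.apply_mem_of_mem_closure {X Y : Type*} [TopologicalSpace X] [TopologicalSpace Y]
    {K : Set Y} (hK : IsClosed K) {f : X → Y} (hf : Continuous f) {s : Set X}
    (hs : ∀ x ∈ s, f x ∈ K) {x : X} (hx : x ∈ closure s) : f x ∈ K := by
  have := map_mem_closure hf hx hs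
  rwa [hK.closure_eq] at this

variable (hK : IsClosed K) (hinv : ∀ φ ∈ relatorAut g, ∀ v ∈ K, tupleAct φ v ∈ K)

include hK hinv

theorem setHandle_mem_of_left {v : Fin g ⊕ Fin g → O2} {i : Fin g} {A B B' : O2}
    (hv : setHandle v i A B ∈ K) (hA : detO2 A = 1) (hA' : ¬ IsOfFinOrder A) (hB : detO2 B = 1)
    (hB' : detO2 B' = 1) : setHandle v i A B' ∈ K := by
  have h := hK.apply_mem_of_mem_closure (f := fun t => setHandle v i A (B * t))
    (continuous_const.setHandle i continuous_const (by fun_prop))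
    (s := Set.range fun n : ℤ => A ^ n) (by
      rintro _ ⟨n, rfl⟩
      obtain ⟨φ, hφ, hφ'⟩ := exists_tupleAct_eq_twistRight (G := O2) i n
      have := hinv φ hφ _ hv
      rw [hφ'] at this
      simpa [twistRight] using this)
    (O2.mem_closure_zpow hA hA' (B := B⁻¹ * B') (by simp [hB, hB']))
  simpa using h

theorem setHandle_mem_of_right {v : Fin g ⊕ Fin g → O2} {i : Fin g} {A A' B : O2}
    (hv : setHandle v i A B ∈ K) (hB : detO2 B = 1) (hB' : ¬ IsOfFinOrder B) (hA : detO2 A = 1)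
    (hA' : detO2 A' = 1) : setHandle v i A' B ∈ K := by
  have h := hK.apply_mem_of_mem_closure (f := fun t => setHandle v i (A * t) B)
    (continuous_const.setHandle i (by fun_prop) continuous_const)
    (s := Set.range fun n : ℤ => B ^ n) (by
      rintro _ ⟨n, rfl⟩
      obtain ⟨φ, hφ, hφ'⟩ := exists_tupleAct_eq_twistLeft (G := O2) i n
      have := hinv φ hφ _ hv
      rw [hφ'] at this
      simpa [twistLeft] using this)
    (O2.mem_closure_zpow hB hB' (B := A⁻¹ * A') (by simp [hA, hA']))
  simpa using h

/-- By closedness the first target entry may be replaced by some `C` of infinite order. The entry of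
infinite order lets the other one become `C`, then `C` moves the remaining entries into place. -/
theorem setHandle_mem {v : Fin g ⊕ Fin g → O2} {i : Fin g} {A B A' B' : O2}
    (hv : setHandle v i A B ∈ K) (hA : detO2 A = 1) (hB : detO2 B = 1)
    (h : ¬ IsOfFinOrder A ∨ ¬ IsOfFinOrder B) (hA' : detO2 A' = 1) (hB' : detO2 B' = 1) :
    setHandle v i A' B' ∈ K := by
  refine hK.apply_mem_of_mem_closure (f := fun t => setHandle v i t B')
    (continuous_const.setHandle i continuous_id continuous_const)
    (s := {A : O2 | detO2 A = 1 ∧ ¬ IsOfFinOrder A}) ?_ (O2.mem_closure_not_isOfFinOrder hA')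
  rintro C ⟨hC, hC'⟩
  rcases h with h | h
  · have h1 := setHandle_mem_of_left hK hinv hv hA h hB hC
    have h2 := setHandle_mem_of_right hK hinv h1 hC hC' hA hC
    exact setHandle_mem_of_left hK hinv h2 hC hC' hC hB'
  · have h2 := setHandle_mem_of_right hK hinv hv hB h hA hC
    exact setHandle_mem_of_left hK hinv h2 hC hC' hB hB'

omit hK in
-- Since rotations commute, the bridge twist leaves both `b` entries alone and transfers a power of
-- `b_i⁻¹ b_j` from `a_i` to `a_j`. If `j` precedes `i`, the bridge is the inverse rotation and the
-- formula is the same.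
theorem bridge_mem {v : Fin g ⊕ Fin g → O2} {i j : Fin g} {A B C D : O2}
    (hij : j.val = i.val + 1 ∨ i.val = j.val + 1)
    (hv : setHandle (setHandle v i A B) j C D ∈ K) (hA : detO2 A = 1) (hB : detO2 B = 1)
    (hC : detO2 C = 1) (hD : detO2 D = 1) (n : ℤ) :
    setHandle (setHandle v i (A * (B⁻¹ * D) ^ (-n)) B) j (C * (B⁻¹ * D) ^ n) D ∈ K := by
  have hne : i ≠ j := by rintro rfl; omega
  have hdn : detO2 ((B⁻¹ * D) ^ n) = 1 := by simp [hB, hD]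
  have hCD : C * D * C⁻¹ = D := by rw [(O2.commute_of_det hC hD).eq, mul_inv_cancel_right]
  have hAB : A * B * A⁻¹ = B := by rw [(O2.commute_of_det hA hB).eq, mul_inv_cancel_right]
  rcases hij with hij | hij
  · obtain ⟨φ, hφ, hφ'⟩ := exists_tupleAct_eq_twistBridge (G := O2) hij n
    have := hinv φ hφ _ hv
    rw [hφ'] at this
    convert this using 1
    have hb : bridge i j (setHandle (setHandle v i A B) j C D) = B⁻¹ * D := by
      simp [bridge, setHandle_inr_of_ne _ hne, hCD]
    funext s
    simp only [twistBridge, hb]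
    rcases s with k | k
    · by_cases hk : k = j
      · subst hk
        simpa using (O2.commute_of_det hC hdn).eq
      · by_cases hk' : k = i
        · subst hk'
          simp [hk, setHandle_inl_of_ne]
        · simp [hk, hk', setHandle_inl_of_ne]
    · by_cases hk' : k = i
      · subst hk'
        simp only [setHandle_inr_of_ne _ hne, setHandle_inr, update_self, update_of_ne, ne_eq,
          reduceCtorEq, not_false_eq_true]
        rw [(O2.commute_of_det hdn hB).eq, zpow_neg, mul_inv_cancel_right]
      · by_cases hk : k = j
        · subst hk
          simp [hk']
        · simp [hk, hk', setHandle_inr_of_ne]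
  · obtain ⟨φ, hφ, hφ'⟩ := exists_tupleAct_eq_twistBridge (G := O2) hij n
    have := hinv φ hφ _ hv
    rw [hφ'] at this
    convert this using 1
    have hb : bridge j i (setHandle (setHandle v i A B) j C D) = (B⁻¹ * D)⁻¹ := by
      simp [bridge, setHandle_inr_of_ne _ hne, setHandle_inl_of_ne _ hne, hAB]
    funext s
    simp only [twistBridge, hb]
    rcases s with k | k
    · by_cases hk : k = i
      · subst hk
        simp only [setHandle_inl_of_ne _ hne, setHandle_inl, update_self, inv_zpow']
        exact (O2.commute_of_det hA (by simp [hB, hD])).eq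
      · by_cases hk' : k = j
        · subst hk'
          simp [hk, -mul_inv_rev]
        · simp [hk, hk', setHandle_inl_of_ne]
    · by_cases hk' : k = j
      · subst hk'
        simp only [setHandle_inr, update_self, update_of_ne, ne_eq,
          reduceCtorEq, not_false_eq_true, inv_zpow', neg_neg]
        rw [(O2.commute_of_det (by simp [hB, hD]) hD).eq, zpow_neg, inv_mul_cancel_right]
      · by_cases hk : k = i
        · subst hk
          simp [hk', setHandle_inr_of_ne]
        · simp [hk, hk', setHandle_inr_of_ne]

/-- Putting `D * t` at `b_i`, with `t` of infinite order, makes the bridge rotation `t⁻¹`. Its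
powers bring `a_j` to `t`, after which `setHandle_mem` gives handle `j` any values. Such `D * t` are
dense among the rotations, so `b_i` is arbitrary too. -/
theorem setHandle_neighbour_mem {v : Fin g ⊕ Fin g → O2} {i j : Fin g} {C D : O2}
    (hij : j.val = i.val + 1 ∨ i.val = j.val + 1)
    (hv : ∀ A B, detO2 A = 1 → detO2 B = 1 → setHandle (setHandle v i A B) j C D ∈ K)
    (hC : detO2 C = 1) (hD : detO2 D = 1) {A B C' D' : O2} (hA : detO2 A = 1) (hB : detO2 B = 1)
    (hC' : detO2 C' = 1) (hD' : detO2 D' = 1) :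
    setHandle (setHandle v i A B) j C' D' ∈ K := by
  have hcont : Continuous fun t : O2 => setHandle (setHandle v i A (D * t)) j C' D' :=
    (continuous_const.setHandle i continuous_const (by fun_prop)).setHandle j continuous_const
      continuous_const
  have h := hK.apply_mem_of_mem_closure hcont (s := {A : O2 | detO2 A = 1 ∧ ¬ IsOfFinOrder A}) ?_
    (O2.mem_closure_not_isOfFinOrder (B := D⁻¹ * B) (by simp [hB, hD]))
  · simpa using h
  rintro t ⟨ht, ht'⟩
  have hDt : detO2 (D * t) = 1 := by simp [hD, ht]
  have hd : (D * t)⁻¹ * D = t⁻¹ := by group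
  have h1 : setHandle (setHandle v i A (D * t)) j t D ∈ K := by
    have hcont' : Continuous fun x : O2 => setHandle (setHandle v i A (D * t)) j (C * x) D :=
      continuous_const.setHandle j (by fun_prop) continuous_const
    have := hK.apply_mem_of_mem_closure hcont' (s := Set.range fun n : ℤ => t⁻¹ ^ n) ?_
      (O2.mem_closure_zpow (by simp [ht]) (by simpa using ht') (B := C⁻¹ * t) (by simp [hC, ht]))
    · simpa using this
    rintro _ ⟨n, rfl⟩
    -- The twist takes `t⁻¹ ^ n` away from `a_i`; starting from `A * t⁻¹ ^ n` makes it end at `A`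
    -- for every `n`.
    have h2 := bridge_mem hinv hij
      (hv (A * t⁻¹ ^ n) (D * t) (by simp [hA, ht]) hDt) (by simp [hA, ht]) hDt hC hD n
    rw [hd] at h2
    simpa using h2
  exact setHandle_mem hK hinv h1 ht hD (Or.inl ht') hC' hD'

/-- If the handles from `m` on are mapped to rotations, and one of them to an infinite group, then
these handles can be moved to arbitrary rotations. -/
theorem mem_of_eq_below {m : ℕ} {v : Fin g ⊕ Fin g → O2} (hv : v ∈ K)
    (hdet : ∀ i : Fin g, m ≤ i.val → detO2 (v (Sum.inl i)) = 1 ∧ detO2 (v (Sum.inr i)) = 1)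
    {i₀ : Fin g} (hi₀ : m ≤ i₀.val)
    (hord : ¬ IsOfFinOrder (v (Sum.inl i₀)) ∨ ¬ IsOfFinOrder (v (Sum.inr i₀)))
    {w : Fin g ⊕ Fin g → O2}
    (hw : ∀ i : Fin g, m ≤ i.val → detO2 (w (Sum.inl i)) = 1 ∧ detO2 (w (Sum.inr i)) = 1)
    (hwv : ∀ i : Fin g, i.val < m → w (Sum.inl i) = v (Sum.inl i) ∧ w (Sum.inr i) = v (Sum.inr i)) :
    w ∈ K := by
  -- `P S` says that the handles in `S` can be set to arbitrary rotations while the others keep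
  -- their values in `v`. A maximal such `S` is closed under passing to neighbours from `m` on, so
  -- it contains all those handles.
  let P (S : Set (Fin g)) : Prop := i₀ ∈ S ∧ (∀ i ∈ S, m ≤ i.val) ∧
    ∀ w : Fin g ⊕ Fin g → O2,
      (∀ i : Fin g, m ≤ i.val → detO2 (w (Sum.inl i)) = 1 ∧ detO2 (w (Sum.inr i)) = 1) →
      (∀ i ∉ S, w (Sum.inl i) = v (Sum.inl i) ∧ w (Sum.inr i) = v (Sum.inr i)) → w ∈ K
  have hbase : P {i₀} := by
    refine ⟨rfl, by rintro i rfl; exact hi₀, fun w hw hwv => ?_⟩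
    have h1 : setHandle w i₀ (v (Sum.inl i₀)) (v (Sum.inr i₀)) ∈ K := by
      convert hv using 1
      funext s
      rcases s with k | k <;> by_cases hk : k = i₀
      · subst hk; simp
      · rw [setHandle_inl_of_ne _ hk]; exact (hwv k hk).1
      · subst hk; simp
      · rw [setHandle_inr_of_ne _ hk]; exact (hwv k hk).2
    have h2 := setHandle_mem hK hinv h1 (hdet i₀ hi₀).1 (hdet i₀ hi₀).2 hord (hw i₀ hi₀).1
      (hw i₀ hi₀).2
    rwa [setHandle_self] at h2
  obtain ⟨S, hS⟩ := (Set.toFinite {S | P S}).exists_maximal ⟨_, hbase⟩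
  have hSP : P S := hS.prop
  have hstep (i j : Fin g) (hi : i ∈ S) (hj : m ≤ j.val)
      (hij : j.val = i.val + 1 ∨ i.val = j.val + 1) : j ∈ S := by
    have hne : i ≠ j := by rintro rfl; omega
    refine hS.le_of_ge (y := insert j S) ?_ (Set.subset_insert _ _) (Set.mem_insert _ _)
    refine ⟨Set.mem_insert_of_mem _ hSP.1, ?_, fun w hw hwv => ?_⟩
    · rintro k (rfl | hk)
      exacts [hj, hSP.2.1 k hk]
    have hfull (A B : O2) (hA : detO2 A = 1) (hB : detO2 B = 1) :
        setHandle (setHandle w i A B) j (v (Sum.inl j)) (v (Sum.inr j)) ∈ K := by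
      refine hSP.2.2 _ (fun k hk => ?_) (fun k hk => ?_)
      · by_cases hkj : k = j
        · subst hkj
          simpa using hdet k hk
        · rw [setHandle_inl_of_ne _ hkj, setHandle_inr_of_ne _ hkj]
          by_cases hki : k = i
          · subst hki
            simpa using ⟨hA, hB⟩
          · rw [setHandle_inl_of_ne _ hki, setHandle_inr_of_ne _ hki]
            exact hw k hk
      · by_cases hkj : k = j
        · subst hkj
          simp
        · have hki : k ≠ i := by rintro rfl; exact hk hi
          rw [setHandle_inl_of_ne _ hkj, setHandle_inr_of_ne _ hkj, setHandle_inl_of_ne _ hki,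
            setHandle_inr_of_ne _ hki]
          exact hwv k (by simp [hkj, hk])
    have hi' := hSP.2.1 i hi
    have h3 := setHandle_neighbour_mem hK hinv hij hfull (hdet j hj).1 (hdet j hj).2 (hw i hi').1
      (hw i hi').2 (hw j hj).1 (hw j hj).2
    rwa [setHandle_self, setHandle_self] at h3
  have hup (n : ℕ) : ∀ j : Fin g, j.val = i₀.val + n → j ∈ S := by
    induction n with
    | zero => intro j hj; obtain rfl : j = i₀ := Fin.ext hj; exact hSP.1
    | succ n ih =>
      intro j hj
      exact hstep ⟨i₀ + n, by omega⟩ j (ih _ rfl) (by omega) (Or.inl (by simp [hj, add_assoc]))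
  have hdown (n : ℕ) : ∀ j : Fin g, m ≤ j.val → j.val + n = i₀.val → j ∈ S := by
    induction n with
    | zero => intro j _ hj; obtain rfl : j = i₀ := Fin.ext hj; exact hSP.1
    | succ n ih =>
      intro j hm hj
      exact hstep ⟨j + 1, by omega⟩ j (ih _ (by simp; omega) (by simp; omega)) hm (Or.inr rfl)
  refine hSP.2.2 w hw fun i hi => hwv i ?_
  by_contra hm
  rw [not_lt] at hm
  rcases le_total i₀.val i.val with h | h
  · exact hi (hup (i.val - i₀.val) i (by omega))
  · exact hi (hdown (i₀.val - i.val) i hm (by omega))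

end Density

/-! ### The obstruction to lifting -/

open scoped ComplexConjugate commutatorElement

namespace O2

/-- The power of `z` of exponent `0` if `d = 1` and of exponent `1` if `d = -1`. -/
noncomputable def signPow (d : ℝ) (z : ℂ) : ℂ := (1 + d) / 2 + (1 - d) / 2 * z

/-- The upper left entry of the commutator in `SL₂(ℂ)` of lifts of `A` and `B`. -/
noncomputable def liftedCommutator (A B : O2) : ℂ :=
  signPow (detO2 B) (point A) * signPow (detO2 A) (conj (point B))

/-- The matrix `diag(z, conj z)`. -/
noncomputable def conjDiag : ℂ →* Matrix (Fin 2) (Fin 2) ℂ where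
  toFun z := !![z, 0; 0, conj z]
  map_one' := by ext i j; fin_cases i <;> fin_cases j <;> simp
  map_mul' z w := by ext i j; fin_cases i <;> fin_cases j <;> simp

@[simp] theorem signPow_one (z : ℂ) : signPow 1 z = 1 := by simp [signPow]

@[simp] theorem signPow_neg_one (z : ℂ) : signPow (-1) z = z := by
  simp only [signPow]; push_cast; ring

theorem conj_root (A : O2) : conj (root A) = (root A)⁻¹ := by
  rw [root, ← Complex.exp_conj, ← Complex.exp_neg]
  simp [Complex.conj_ofReal, map_ofNat (starRingEnd ℂ) 2]

/-- Each lift occurs together with its inverse, so the choice of square roots cancels and only `root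
A ^ 2 = point A` and its analogue for `B` remain. -/
theorem commutator_toSL (A B : O2) :
    ((⁅toSL A, toSL B⁆ : Matrix.SpecialLinearGroup (Fin 2) ℂ) : Matrix (Fin 2) (Fin 2) ℂ) =
      conjDiag (liftedCommutator A B) := by
  have h1 : ¬ ((-1 : ℝ) = 1) := by norm_num
  have e (X Y : Matrix.SpecialLinearGroup (Fin 2) ℂ) :
      ((⁅X, Y⁆ : Matrix.SpecialLinearGroup (Fin 2) ℂ) : Matrix (Fin 2) (Fin 2) ℂ) =
        X.1 * Y.1 * X.1.adjugate * Y.1.adjugate := by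
    simp [commutatorElement_def]
  rw [e]
  have hA' : A.1.det = detO2 A := rfl
  have hB' : B.1.det = detO2 B := rfl
  simp only [toSL, toMatrix, liftedCommutator, conjDiag, MonoidHom.coe_mk, OneHom.coe_mk, hA', hB',
    ← root_sq]
  have nA := root_ne_zero A
  have nB := root_ne_zero B
  have cA := conj_root A
  have cB := conj_root B
  generalize root A = x at *
  generalize root B = y at *
  rcases det_eq A with hA | hA <;> rcases det_eq B with hB | hB <;>
    simp only [hA, hB, signPow_one, signPow_neg_one, if_true, if_neg h1, Matrix.adjugate_fin_two_of,
      Matrix.mul_fin_two, map_mul, map_one, one_mul, mul_one, map_inv₀, cA, cB]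
  · ext i j
    fin_cases i <;> fin_cases j <;> simp <;> field_simp
  · ext i j
    fin_cases i <;> fin_cases j <;> simp <;> field_simp <;> simp [Complex.I_sq]
  · ext i j
    fin_cases i <;> fin_cases j <;> simp <;> field_simp <;> simp [Complex.I_sq]
  · ext i j
    fin_cases i <;> fin_cases j <;> simp <;> field_simp <;> simp [Complex.I_pow_four]

/-- The upper left entry of the value in `SL₂(ℂ)` of the surface relator on lifts of `v`. -/
noncomputable def obstruction {g : ℕ} (v : Fin g ⊕ Fin g → O2) : ℂ :=
  ∏ i, liftedCommutator (v (Sum.inl i)) (v (Sum.inr i))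

theorem relatorValue_toSL {g : ℕ} (v : Fin g ⊕ Fin g → O2) :
    ((relatorValue (toSL ∘ v) : Matrix.SpecialLinearGroup (Fin 2) ℂ) : Matrix (Fin 2) (Fin 2) ℂ) =
      conjDiag (obstruction v) := by
  let ι : Matrix.SpecialLinearGroup (Fin 2) ℂ →* Matrix (Fin 2) (Fin 2) ℂ :=
    ⟨⟨Subtype.val, rfl⟩, fun _ _ => rfl⟩
  change ι (relatorValue (toSL ∘ v)) = _
  rw [relatorValue, map_list_prod, List.map_ofFn, obstruction, ← List.prod_ofFn, map_list_prod,
    List.map_ofFn]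
  congr 2
  funext i
  exact commutator_toSL _ _

theorem conjDiag_eq_one_iff {z : ℂ} : conjDiag z = 1 ↔ z = 1 := by
  refine ⟨fun h => ?_, fun h => by rw [h, map_one]⟩
  simpa [conjDiag] using congrFun (congrFun h 0) 0

theorem relatorValue_toSL_eq_one_iff {g : ℕ} (v : Fin g ⊕ Fin g → O2) :
    relatorValue (toSL ∘ v) = 1 ↔ obstruction v = 1 := by
  rw [← conjDiag_eq_one_iff, ← relatorValue_toSL]
  exact Subtype.ext_iff

/-- Commutators do not see central factors, so the lifted relator does not depend on the lifts. A
representation therefore lifts exactly when the particular lifts `toSL` satisfy the relation. -/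
theorem relatorValue_eq_of_mk_eq {g : ℕ}
    {v w : Fin g ⊕ Fin g → Matrix.SpecialLinearGroup (Fin 2) ℂ}
    (h : ∀ s, (QuotientGroup.mk (v s) : PSL2C) = QuotientGroup.mk (w s)) :
    relatorValue v = relatorValue w := by
  refine congrArg (fun f => (List.ofFn f).prod) (funext fun k => ?_)
  have hz (s) : ∃ z ∈ Subgroup.center (Matrix.SpecialLinearGroup (Fin 2) ℂ), w s = v s * z :=
    ⟨_, QuotientGroup.eq.1 (h s), by group⟩
  obtain ⟨x, hx, hx'⟩ := hz (Sum.inl k)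
  obtain ⟨y, hy, hy'⟩ := hz (Sum.inr k)
  rw [hx', hy']
  have cx (z) : z * x = x * z := Subgroup.mem_center_iff.1 hx z
  have cy (z) : z * y = y * z := Subgroup.mem_center_iff.1 hy z
  generalize v (Sum.inl k) = a
  generalize v (Sum.inr k) = b
  calc ⁅a, b⁆ = a * b * a⁻¹ * y * y⁻¹ * b⁻¹ := by simp [commutatorElement_def]
    _ = a * (b * y * x) * x⁻¹ * a⁻¹ * y⁻¹ * b⁻¹ := by
      rw [mul_assoc (a * b), cy a⁻¹]
      simp only [mul_assoc, mul_inv_cancel_left]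
    _ = ⁅a * x, b * y⁆ := by
      rw [cx]
      simp only [commutatorElement_def, mul_inv_rev, mul_assoc]

theorem sw_toPSL_eq_zero_iff {g : ℕ} (ρ : SurfaceGroup g →* O2) :
    sw (toPSL.comp ρ) = 0 ↔ obstruction (genTuple ρ) = 1 := by
  rw [← relatorValue_toSL_eq_one_iff, sw]
  constructor
  · intro h
    split_ifs at h with h1
    · obtain ⟨ρ', h1⟩ := h1
      rw [← relatorValue_genTuple ρ']
      exact relatorValue_eq_of_mk_eq fun s => (h1 _).symm
    · exact absurd h one_ne_zero
  · intro h
    rw [if_pos]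
    refine ⟨PresentedGroup.toGroup (f := toSL ∘ genTuple ρ) ?_, fun x => ?_⟩
    · rintro _ rfl
      rw [lift_surfaceRelator, h]
    · refine DFunLike.congr_fun (f := (QuotientGroup.mk' _).comp _)
        (PresentedGroup.ext fun s => ?_) x
      simp
      rfl

/-- The lifted relator is trivial in `PSL₂(ℂ)`, hence a scalar matrix of determinant `1`. -/
theorem obstruction_eq {g : ℕ} (v : Fin g ⊕ Fin g → O2) (hv : relatorValue v = 1) :
    obstruction v = 1 ∨ obstruction v = -1 := by
  have h1 : (QuotientGroup.mk (relatorValue (toSL ∘ v)) : PSL2C) = 1 := by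
    refine (map_relatorValue (QuotientGroup.mk' _) _).trans ?_
    have := map_relatorValue toPSL v
    rw [hv, map_one] at this
    exact this.symm
  rw [QuotientGroup.eq_one_iff, Matrix.SpecialLinearGroup.mem_center_iff] at h1
  obtain ⟨r, hr, h2⟩ := h1
  rw [Fintype.card_fin] at hr
  have h3 : r = obstruction v := by
    have := congrFun (congrFun (h2.trans (relatorValue_toSL v)) 0) 0
    simpa [conjDiag] using this
  rw [h3] at hr
  exact sq_eq_one_iff.1 hr

theorem continuous_detO2 : Continuous detO2 := by
  have : Continuous fun A : O2 => A.1.det := Continuous.matrix_det continuous_subtype_val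
  exact this

theorem continuous_point : Continuous point := by
  have h : point = fun A : O2 => (A.1 0 0 : ℂ) + A.1 1 0 * Complex.I := by
    funext A
    apply Complex.ext <;> simp [point]
  rw [h]
  have h (i j) : Continuous fun A : O2 => A.1 i j := continuous_subtype_val.matrix_elem i j
  exact (Complex.continuous_ofReal.comp (h 0 0)).add
    ((Complex.continuous_ofReal.comp (h 1 0)).mul continuous_const)

/-- Although `toSL` involves a discontinuous square root, the obstruction is built from determinants
and `point`; the polynomial form of `signPow` avoids a case distinction on the determinant. -/
theorem continuous_obstruction {g : ℕ} :
    Continuous (obstruction : (Fin g ⊕ Fin g → O2) → ℂ) := by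
  have h1 := continuous_detO2
  have h2 := continuous_point
  have h3 : Continuous fun z : ℂ => conj z := Complex.continuous_conj
  unfold obstruction liftedCommutator signPow
  fun_prop

end O2

/-! ### Normal forms of tuples of orthogonal matrices -/

section NormalForm

variable {g : ℕ}

/-- `w` is obtained from `v` by an automorphism that preserves the surface relator. -/
def Reaches (v w : Fin g ⊕ Fin g → O2) : Prop := ∃ φ ∈ relatorAut g, tupleAct φ v = w

theorem Reaches.refl (v : Fin g ⊕ Fin g → O2) : Reaches v v := ⟨1, one_mem _, tupleAct_one v⟩

theorem Reaches.trans {u v w : Fin g ⊕ Fin g → O2} (h : Reaches u v) (h' : Reaches v w) :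
    Reaches u w := by
  obtain ⟨φ, hφ, rfl⟩ := h
  obtain ⟨ψ, hψ, rfl⟩ := h'
  exact ⟨φ * ψ, mul_mem hφ hψ, tupleAct_mul φ ψ u⟩

theorem Reaches.symm {v w : Fin g ⊕ Fin g → O2} (h : Reaches v w) : Reaches w v := by
  obtain ⟨φ, hφ, rfl⟩ := h
  exact ⟨φ⁻¹, inv_mem hφ, by rw [← tupleAct_mul, mul_inv_cancel, tupleAct_one]⟩

theorem reaches_twistRight (i : Fin g) (v : Fin g ⊕ Fin g → O2) : Reaches v (twistRight i 1 v) := by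
  obtain ⟨φ, hφ, h⟩ := exists_tupleAct_eq_twistRight (G := O2) i 1
  exact ⟨φ, hφ, h v⟩

theorem reaches_twistLeft (i : Fin g) (v : Fin g ⊕ Fin g → O2) : Reaches v (twistLeft i 1 v) := by
  obtain ⟨φ, hφ, h⟩ := exists_tupleAct_eq_twistLeft (G := O2) i 1
  exact ⟨φ, hφ, h v⟩

theorem reaches_twistBridge {i j : Fin g} (hij : j.val = i.val + 1) (v : Fin g ⊕ Fin g → O2) :
    Reaches v (twistBridge i j 1 v) := by
  obtain ⟨φ, hφ, h⟩ := exists_tupleAct_eq_twistBridge (G := O2) hij 1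
  exact ⟨φ, hφ, h v⟩

/-- The tuple `v` has rotations at the handle `i`. -/
def RotationsAt (v : Fin g ⊕ Fin g → O2) (i : Fin g) : Prop :=
  detO2 (v (Sum.inl i)) = 1 ∧ detO2 (v (Sum.inr i)) = 1

/-- The tuples `v` and `w` agree at the handle `i`. -/
def AgreeAt (v w : Fin g ⊕ Fin g → O2) (i : Fin g) : Prop :=
  w (Sum.inl i) = v (Sum.inl i) ∧ w (Sum.inr i) = v (Sum.inr i)

theorem AgreeAt.trans {u v w : Fin g ⊕ Fin g → O2} {i : Fin g} (h : AgreeAt u v i)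
    (h' : AgreeAt v w i) : AgreeAt u w i :=
  ⟨h'.1.trans h.1, h'.2.trans h.2⟩

theorem AgreeAt.rotationsAt_iff {v w : Fin g ⊕ Fin g → O2} {i : Fin g} (h : AgreeAt v w i) :
    RotationsAt w i ↔ RotationsAt v i := by
  rw [RotationsAt, RotationsAt, h.1, h.2]

theorem agreeAt_twistRight {i k : Fin g} (h : k ≠ i) (v : Fin g ⊕ Fin g → O2) :
    AgreeAt v (twistRight i 1 v) k := by
  simp [AgreeAt, twistRight, h]

theorem agreeAt_twistLeft {i k : Fin g} (h : k ≠ i) (v : Fin g ⊕ Fin g → O2) :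
    AgreeAt v (twistLeft i 1 v) k := by
  simp [AgreeAt, twistLeft, h]

theorem agreeAt_twistBridge {i j k : Fin g} (h : k ≠ i) (h' : k ≠ j) (v : Fin g ⊕ Fin g → O2) :
    AgreeAt v (twistBridge i j 1 v) k := by
  simp [AgreeAt, twistBridge, h, h']

/-- On the signs of a handle the twists generate `SL₂(𝔽₂)`, which is transitive on nonzero vectors:
unless both entries are rotations, the signs `(1, -1)` can be reached. -/
theorem exists_reaches_det_inl (v : Fin g ⊕ Fin g → O2) (i : Fin g) :
    ∃ w, Reaches v w ∧ (∀ k, k ≠ i → AgreeAt v w k) ∧ detO2 (w (Sum.inl i)) = 1 ∧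
      (detO2 (w (Sum.inr i)) = 1 → RotationsAt v i) := by
  rcases O2.det_eq (v (Sum.inl i)) with ha | ha
  · exact ⟨v, .refl v, fun k _ => ⟨rfl, rfl⟩, ha, fun hb => ⟨ha, hb⟩⟩
  rcases O2.det_eq (v (Sum.inr i)) with hb | hb
  · refine ⟨_, (reaches_twistRight i v).trans (reaches_twistLeft i _),
      fun k hk => (agreeAt_twistRight hk v).trans (agreeAt_twistLeft hk _), ?_, ?_⟩
    · simp [twistRight, twistLeft, ha, hb]
    · simp [twistRight, twistLeft, ha, hb]
      norm_num
  · refine ⟨_, reaches_twistLeft i v, fun k hk => agreeAt_twistLeft hk v, ?_, ?_⟩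
    · simp [twistLeft, ha, hb]
    · simp [twistLeft, hb]
      norm_num

theorem exists_reaches_det_inr (v : Fin g ⊕ Fin g → O2) (i : Fin g) :
    ∃ w, Reaches v w ∧ (∀ k, k ≠ i → AgreeAt v w k) ∧ detO2 (w (Sum.inr i)) = 1 := by
  rcases O2.det_eq (v (Sum.inr i)) with hb | hb
  · exact ⟨v, .refl v, fun k _ => ⟨rfl, rfl⟩, hb⟩
  rcases O2.det_eq (v (Sum.inl i)) with ha | ha
  · refine ⟨_, (reaches_twistLeft i v).trans (reaches_twistRight i _),
      fun k hk => (agreeAt_twistLeft hk v).trans (agreeAt_twistRight hk _), ?_⟩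
    simp [twistRight, twistLeft, ha, hb]
  · refine ⟨_, reaches_twistRight i v, fun k hk => agreeAt_twistRight hk v, ?_⟩
    simp [twistRight, ha, hb]

/-- With signs `(1, -1)` at `i` and `b_j` a rotation, the bridge has determinant `-1`, so its twist
corrects the sign of `a_j` if necessary. -/
theorem exists_reaches_rotationsAt_of_not {i j : Fin g} (hij : j.val = i.val + 1)
    (v : Fin g ⊕ Fin g → O2) (hi : ¬ RotationsAt v i) :
    ∃ w, Reaches v w ∧ (∀ k, k ≠ i → k ≠ j → AgreeAt v w k) ∧ RotationsAt w j := by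
  have hne : i ≠ j := by rintro rfl; omega
  obtain ⟨u, hu, hu1, hu2, hu3⟩ := exists_reaches_det_inl v i
  obtain ⟨w, hw, hw1, hw2⟩ := exists_reaches_det_inr u j
  have hwb : detO2 (w (Sum.inr i)) = -1 := by
    rw [(hw1 i hne).2]
    exact O2.det_ne_one.1 fun h => hi (hu3 h)
  rcases O2.det_eq (w (Sum.inl j)) with ha | ha
  · exact ⟨w, hu.trans hw, fun k hk hk' => (hu1 k hk).trans (hw1 k hk'), ha, hw2⟩
  · refine ⟨_, (hu.trans hw).trans (reaches_twistBridge hij w),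
      fun k hk hk' => ((hu1 k hk).trans (hw1 k hk')).trans (agreeAt_twistBridge hk hk' w), ?_, ?_⟩
    · simp [twistBridge, bridge, ha, hw2, hwb]
    · simp [twistBridge, hne.symm, hw2]

theorem exists_reaches_rotationsAt {i j : Fin g} (hij : j.val = i.val + 1)
    (v : Fin g ⊕ Fin g → O2) :
    ∃ w, Reaches v w ∧ (∀ k, k ≠ i → k ≠ j → AgreeAt v w k) ∧ RotationsAt w j := by
  have hne : i ≠ j := by rintro rfl; omega
  by_cases hi : RotationsAt v i
  swap
  · exact exists_reaches_rotationsAt_of_not hij v hi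
  by_cases hj : RotationsAt v j
  · exact ⟨v, .refl v, fun k _ _ => ⟨rfl, rfl⟩, hj⟩
  obtain ⟨u, hu, hu1, hu2, hu3⟩ := exists_reaches_det_inl v j
  have hub : detO2 (u (Sum.inr j)) = -1 := O2.det_ne_one.1 fun h => hj (hu3 h)
  have hui := (hu1 i hne).rotationsAt_iff.2 hi
  -- With only `b_j` a reflection, the bridge twist turns `a_i` into one, which reduces to the
  -- previous lemma.
  have hnot : ¬ RotationsAt (twistBridge i j 1 u) i := by
    rintro ⟨h, -⟩
    simp [twistBridge, bridge, hne, hui.1, hui.2, hub, hu2] at h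
    norm_num at h
  obtain ⟨w, hw, hw1, hw2⟩ := exists_reaches_rotationsAt_of_not hij _ hnot
  exact ⟨w, (hu.trans (reaches_twistBridge hij u)).trans hw, fun k hk hk' =>
    ((hu1 k hk').trans (agreeAt_twistBridge hk hk' u)).trans (hw1 k hk hk'), hw2⟩

/-- Reflections are pushed from the last handle towards the first: `n` counts the handles already
cleared at the end, and the next step changes only the two handles before them. -/
theorem exists_reaches_rotationsAt_pos (v : Fin g ⊕ Fin g → O2) :
    ∃ w, Reaches v w ∧ ∀ i : Fin g, 1 ≤ i.val → RotationsAt w i := by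
  suffices h : ∀ n : ℕ, ∃ w, Reaches v w ∧
      ∀ i : Fin g, 1 ≤ i.val → g ≤ i.val + n → RotationsAt w i by
    obtain ⟨w, hw, hw'⟩ := h g
    exact ⟨w, hw, fun i hi => hw' i hi (by omega)⟩
  intro n
  induction n with
  | zero => exact ⟨v, .refl v, fun i _ hi => by omega⟩
  | succ n ih =>
    obtain ⟨u, hu, hu'⟩ := ih
    by_cases hn : n + 2 ≤ g
    · let j : Fin g := ⟨g - (n + 1), by omega⟩
      let i : Fin g := ⟨g - (n + 2), by omega⟩
      obtain ⟨w, hw, hw1, hw2⟩ := exists_reaches_rotationsAt (i := i) (j := j)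
        (by simp only [i, j]; omega) u
      refine ⟨w, hu.trans hw, fun k hk hk' => ?_⟩
      by_cases hkj : k = j
      · rw [hkj]; exact hw2
      · have hkj' : k.val ≠ g - (n + 1) := fun h => hkj (Fin.ext h)
        have hki : k ≠ i := by
          rintro rfl
          simp only [i] at hk'
          omega
        exact (hw1 k hki hkj).rotationsAt_iff.2 (hu' k hk (by omega))
    · exact ⟨u, hu, fun k hk hk' => hu' k hk (by omega)⟩

theorem det_lift_eq_one {ι : Type*} {v : ι → O2} (h : ∀ s, detO2 (v s) = 1) (x : FreeGroup ι) :
    detO2 (FreeGroup.lift v x) = 1 := by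
  have : detO2.comp (FreeGroup.lift v) = 1 := FreeGroup.ext_hom _ _ fun s => by simp [h]
  exact DFunLike.congr_fun this x

theorem Reaches.det_eq_one {v w : Fin g ⊕ Fin g → O2} (h : Reaches v w)
    (hv : ∀ s, detO2 (v s) = 1) (s) : detO2 (w s) = 1 := by
  obtain ⟨φ, -, rfl⟩ := h
  exact det_lift_eq_one hv _

/-- The tuples with a reflection at `b₁` and rotations elsewhere. -/
structure IsNormal (o : Fin g) (v : Fin g ⊕ Fin g → O2) : Prop where
  inl_zero : detO2 (v (Sum.inl o)) = 1
  inr_zero : detO2 (v (Sum.inr o)) = -1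
  rotationsAt : ∀ i : Fin g, 1 ≤ i.val → RotationsAt v i

theorem exists_reaches_isNormal {o : Fin g} (ho : o.val = 0) (v : Fin g ⊕ Fin g → O2)
    (hv : ¬ ∀ s, detO2 (v s) = 1) : ∃ w, Reaches v w ∧ IsNormal o w := by
  obtain ⟨u, hu, hu'⟩ := exists_reaches_rotationsAt_pos v
  obtain ⟨w, hw, hw1, hw2, hw3⟩ := exists_reaches_det_inl u o
  have hpos (i : Fin g) (hi : 1 ≤ i.val) : RotationsAt w i :=
    (hw1 i (by rintro rfl; omega)).rotationsAt_iff.2 (hu' i hi)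
  refine ⟨w, hu.trans hw, hw2, O2.det_ne_one.1 fun hb => hv ?_, hpos⟩
  refine (hu.trans hw).symm.det_eq_one ?_
  have hall (i : Fin g) : RotationsAt w i := by
    by_cases hi : 1 ≤ i.val
    · exact hpos i hi
    · obtain rfl : i = o := Fin.ext (by omega)
      exact ⟨hw2, hb⟩
  rintro (i | i)
  exacts [(hall i).1, (hall i).2]

theorem Reaches.relatorValue_eq_one {v w : Fin g ⊕ Fin g → O2} (h : Reaches v w)
    (hv : relatorValue v = 1) : relatorValue w = 1 := by
  obtain ⟨φ, hφ, rfl⟩ := h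
  rw [← lift_surfaceRelator, lift_tupleAct]
  obtain ⟨x, hx⟩ := isConj_iff.1 hφ
  rw [← hx]
  simp [lift_surfaceRelator, hv]

theorem Reaches.range_lift {v w : Fin g ⊕ Fin g → O2} (h : Reaches v w) :
    Set.range (FreeGroup.lift w) = Set.range (FreeGroup.lift v) := by
  obtain ⟨φ, hφ, rfl⟩ := h
  have : (FreeGroup.lift (tupleAct φ v) : _ → O2) = FreeGroup.lift v ∘ φ :=
    funext fun x => lift_tupleAct φ v x
  rw [this, φ.surjective.range_comp]

theorem O2.mk_toSL_lift {ι : Type*} (v : ι → O2) (x : FreeGroup ι) :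
    (QuotientGroup.mk (FreeGroup.lift (O2.toSL ∘ v) x) : PSL2C) =
      QuotientGroup.mk (O2.toSL (FreeGroup.lift v x)) := by
  have : (QuotientGroup.mk' _).comp (FreeGroup.lift (O2.toSL ∘ v)) =
      O2.toPSL.comp (FreeGroup.lift v) := FreeGroup.ext_hom _ _ fun s => by
    simp
    rfl
  exact DFunLike.congr_fun this x

/-- Lifting and acting by `φ` commute up to signs, which the relator ignores, and `φ` only
conjugates the relator. -/
theorem Reaches.obstruction_eq_one {v w : Fin g ⊕ Fin g → O2} (h : Reaches v w)
    (hv : O2.obstruction v = 1) : O2.obstruction w = 1 := by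
  obtain ⟨φ, hφ, rfl⟩ := h
  rw [← O2.relatorValue_toSL_eq_one_iff] at hv ⊢
  have h1 : relatorValue (O2.toSL ∘ tupleAct φ v) = relatorValue (tupleAct φ (O2.toSL ∘ v)) :=
    O2.relatorValue_eq_of_mk_eq fun s => (O2.mk_toSL_lift v _).symm
  rw [h1, ← lift_surfaceRelator, lift_tupleAct]
  obtain ⟨x, hx⟩ := isConj_iff.1 hφ
  rw [← hx]
  simp [lift_surfaceRelator, hv]

/-- All handles but the first consist of rotations, whose lifts commute. -/
theorem IsNormal.obstruction_eq {o : Fin g} (ho : o.val = 0) {v : Fin g ⊕ Fin g → O2}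
    (h : IsNormal o v) : O2.obstruction v = O2.point (v (Sum.inl o)) := by
  rw [O2.obstruction, Finset.prod_eq_single o]
  · simp [O2.liftedCommutator, h.inl_zero, h.inr_zero]
  · intro i _ hi
    have hi' : 1 ≤ i.val := by
      by_contra h0
      exact hi (Fin.ext (by omega))
    simp [O2.liftedCommutator, (h.rotationsAt i hi').1, (h.rotationsAt i hi').2]
  · simp

theorem O2.ext_of_point {A B : O2} (hA : detO2 A = 1) (hB : detO2 B = 1)
    (h : point A = point B) : A = B := by
  have h1 : ¬ ((1 : ℝ) = -1) := by norm_num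
  have h0 := congrArg Complex.re h
  have h2 := congrArg Complex.im h
  simp only [point] at h0 h2
  change A.1.det = 1 at hA
  change B.1.det = 1 at hB
  have eA := (entries A).2
  have eB := (entries B).2
  simp only [hA, hB, h1, false_and, or_false, true_and] at eA eB
  apply Subtype.ext
  ext i j
  fin_cases i <;> fin_cases j <;> simp [h0, h2, eA.1, eA.2, eB.1, eB.2]

theorem O2.point_mul {A B : O2} (hA : detO2 A = 1) : point (A * B) = point A * point B := by
  have h1 : ¬ ((1 : ℝ) = -1) := by norm_num
  change A.1.det = 1 at hA
  have eA := (entries A).2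
  simp only [hA, h1, false_and, or_false, true_and] at eA
  apply Complex.ext <;>
    simp [point, Matrix.mul_apply, Fin.sum_univ_two, eA.1, eA.2] <;> ring

theorem O2.point_one : point 1 = 1 := by
  apply Complex.ext <;> simp [point]

theorem O2.isOfFinOrder_of_point {A : O2} (hA : detO2 A = 1) (h : point A = 1 ∨ point A = -1) :
    IsOfFinOrder A := by
  refine isOfFinOrder_iff_pow_eq_one.2 ⟨2, by norm_num, ?_⟩
  refine ext_of_point (by simp [hA]) (by simp) ?_
  rw [sq, point_mul hA, point_one]
  rcases h with h | h <;> simp [h]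

end NormalForm

/-! ### Tuples with equal invariants lie in the same closed invariant sets. -/

section Main

variable {g : ℕ} {K : Set (Fin g ⊕ Fin g → O2)}

theorem mem_of_isNormal (hK : IsClosed K)
    (hinv : ∀ φ ∈ relatorAut g, ∀ v ∈ K, tupleAct φ v ∈ K) {o : Fin g} (ho : o.val = 0)
    {v w : Fin g ⊕ Fin g → O2} (hv : v ∈ K) (hvn : IsNormal o v) (hwn : IsNormal o w)
    (hvw : w (Sum.inl o) = v (Sum.inl o)) {i₀ : Fin g} (hi₀ : 1 ≤ i₀.val)
    (hord : ¬ IsOfFinOrder (v (Sum.inl i₀)) ∨ ¬ IsOfFinOrder (v (Sum.inr i₀))) : w ∈ K := by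
  have hoi : o ≠ i₀ := by rintro rfl; omega
  have hcont : Continuous fun t : O2 => update w (Sum.inl i₀) t :=
    continuous_const.update _ continuous_id
  have h := hK.apply_mem_of_mem_closure hcont (s := {A : O2 | detO2 A = 1 ∧ ¬ IsOfFinOrder A}) ?_
    (O2.mem_closure_not_isOfFinOrder (hwn.rotationsAt i₀ hi₀).1)
  · simpa using h
  rintro t ⟨ht, ht'⟩
  set S := v (Sum.inr o) with hS
  have hcont' : Continuous fun R : O2 =>
      update (update w (Sum.inl i₀) t) (Sum.inr o) (S * R) :=
    continuous_const.update _ (by fun_prop)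
  have hrot (R : O2) (i : Fin g) (hi : 1 ≤ i.val) :
      RotationsAt (update (update w (Sum.inl i₀) t) (Sum.inr o) R) i := by
    have hio : i ≠ o := by rintro rfl; omega
    have := hwn.rotationsAt i hi
    by_cases hii : i = i₀
    · subst hii
      simpa [RotationsAt, hio, ht] using this.2
    · simpa [RotationsAt, hio, hii] using this
  have h0 : update (update w (Sum.inl i₀) t) (Sum.inr o) S ∈ K := by
    refine mem_of_eq_below hK hinv hv hvn.rotationsAt hi₀ hord (hrot S) fun i hi => ?_
    obtain rfl : i = o := Fin.ext (by omega)
    simpa [hoi, hS] using hvw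
  have h1 := hK.apply_mem_of_mem_closure hcont'
    -- Conjugation by `t ^ n` fixes all rotations and sends the reflection `S` to `S * (t⁻¹ * t⁻¹) ^
    -- n`; since `t ^ 2` has infinite order too, these are dense among the reflections.
    (s := Set.range fun n : ℤ => (t⁻¹ * t⁻¹) ^ n) ?_
    (O2.mem_closure_zpow (by simp [ht])
      (fun h2 => ht' ?_) (B := S⁻¹ * w (Sum.inr o)) (by simp [hS, hvn.inr_zero, hwn.inr_zero]))
  · have h3 : update w (Sum.inl i₀) t (Sum.inr o) = w (Sum.inr o) := by simp
    rw [mul_inv_cancel_left, ← h3, update_eq_self] at h1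
    exact h1
  · rintro _ ⟨n, rfl⟩
    obtain ⟨φ, hφ, hφ'⟩ := exists_tupleAct_eq_conj (G := O2)
      (FreeGroup.of (Sum.inl i₀ : Fin g ⊕ Fin g) ^ n)
    convert hinv φ hφ _ h0 using 1
    funext s
    rw [hφ']
    have ht2 : FreeGroup.lift (update (update w (Sum.inl i₀) t) (Sum.inr o) S)
        (FreeGroup.of (Sum.inl i₀ : Fin g ⊕ Fin g) ^ n) = t ^ n := by
      simp
    have htn : detO2 (t ^ n) = 1 := by simp [ht]
    rw [ht2]
    have hcomm (A : O2) (hA : detO2 A = 1) : t ^ n * A * (t ^ n)⁻¹ = A := by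
      rw [(O2.commute_of_det htn hA).eq, mul_inv_cancel_right]
    by_cases hs : s = Sum.inr o
    · subst hs
      rw [update_self, update_self]
      have h4 := O2.conj_eq_inv (A := (t ^ n)⁻¹) (S := S) (by simp [ht]) hvn.inr_zero
      rw [inv_inv] at h4
      simp only [← h4, mul_assoc, (Commute.refl t⁻¹).mul_zpow, inv_zpow]
    · rw [update_of_ne hs, update_of_ne hs, hcomm]
      rcases s with i | i
      · by_cases hi : 1 ≤ i.val
        · simpa [RotationsAt] using (hrot S i hi).1
        · obtain rfl : i = o := Fin.ext (by omega)
          simpa [hoi] using hwn.inl_zero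
      · have hi : 1 ≤ i.val := by
          by_contra h0
          exact hs (congrArg Sum.inr (Fin.ext (by omega)))
        simpa [RotationsAt] using (hwn.rotationsAt i hi).2
  · rw [← mul_inv_rev, isOfFinOrder_inv_iff, ← sq] at h2
    exact h2.of_pow (by norm_num)

/-- A closed set of tuples that is invariant under the automorphisms preserving the surface relator
and contains a tuple that generates an infinite group contains every tuple with the same
invariants. -/
theorem mem_of_invariants_eq (hK : IsClosed K)
    (hinv : ∀ φ ∈ relatorAut g, ∀ v ∈ K, tupleAct φ v ∈ K) {v w : Fin g ⊕ Fin g → O2} (hv : v ∈ K)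
    (hinf : (Set.range (FreeGroup.lift v)).Infinite) (hvr : relatorValue v = 1)
    (hwr : relatorValue w = 1)
    (hdet : (∀ s, detO2 (w s) = 1) ↔ ∀ s, detO2 (v s) = 1)
    (hobs : O2.obstruction w = 1 ↔ O2.obstruction v = 1) : w ∈ K := by
  have hinv' {u u' : Fin g ⊕ Fin g → O2} (h : Reaches u u') (hu : u ∈ K) : u' ∈ K := by
    obtain ⟨φ, hφ, rfl⟩ := h
    exact hinv φ hφ u hu
  by_cases hd : ∀ s, detO2 (v s) = 1
  · obtain ⟨S, hS⟩ := O2.exists_det_eq_neg_one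
    obtain ⟨s, ⟨-, hs⟩ | ⟨hs, -⟩⟩ := O2.exists_not_isOfFinOrder_of_infinite v hS hinf
    · have h1 (i₀ : Fin g) := mem_of_eq_below (m := 0) hK hinv hv (fun i _ => ⟨hd _, hd _⟩)
        (i₀ := i₀) (Nat.zero_le _)
      have hw := hdet.2 hd
      rcases s with i₀ | i₀
      · exact h1 i₀ (Or.inl hs) (fun i _ => ⟨hw _, hw _⟩) fun i hi => absurd hi (Nat.not_lt_zero _)
      · exact h1 i₀ (Or.inr hs) (fun i _ => ⟨hw _, hw _⟩) fun i hi => absurd hi (Nat.not_lt_zero _)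
    · rw [hd s] at hs
      norm_num at hs
  · obtain ⟨s, -⟩ := not_forall.1 hd
    have hg : 0 < g := by
      rcases s with i | i <;> exact i.pos
    have hdw : ¬ ∀ s, detO2 (w s) = 1 := fun h => hd (hdet.1 h)
    obtain ⟨v', hvv, hvn⟩ := exists_reaches_isNormal (o := ⟨0, hg⟩) rfl v hd
    obtain ⟨w', hww, hwn⟩ := exists_reaches_isNormal (o := ⟨0, hg⟩) rfl w hdw
    have hvo := O2.obstruction_eq v' (hvv.relatorValue_eq_one hvr)
    have hwo := O2.obstruction_eq w' (hww.relatorValue_eq_one hwr)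
    have hiff : O2.obstruction w' = 1 ↔ O2.obstruction v' = 1 :=
      ⟨fun h => hvv.obstruction_eq_one (hobs.1 (hww.symm.obstruction_eq_one h)),
        fun h => hww.obstruction_eq_one (hobs.2 (hvv.symm.obstruction_eq_one h))⟩
    have hoeq : O2.obstruction w' = O2.obstruction v' := by
      rcases hvo with h | h
      · rw [h, hiff.2 h]
      · rw [h]
        refine hwo.resolve_left fun h' => ?_
        rw [hiff.1 h'] at h
        norm_num at h
    rw [hwn.obstruction_eq rfl, hvn.obstruction_eq rfl] at hoeq
    have hvw := O2.ext_of_point hwn.inl_zero hvn.inl_zero hoeq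
    rw [hvn.obstruction_eq rfl] at hvo
    have hfin := O2.isOfFinOrder_of_point hvn.inl_zero hvo
    refine hinv' hww.symm ?_
    have hpos (i : Fin g) (hi : i ≠ ⟨0, hg⟩) : 1 ≤ i.val := by
      by_contra h0
      exact hi (Fin.ext (by simp; omega))
    have main (i₀ : Fin g) (hi₀ : 1 ≤ i₀.val) := mem_of_isNormal hK hinv (o := ⟨0, hg⟩) rfl
      (hinv' hvv hv) hvn hwn hvw hi₀
    -- With `b₁` itself as auxiliary reflection, `b₁ * S = 1`; as `a₁ = ±1` has finite order, the
    -- infinite order must come from a later handle.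
    obtain ⟨s, hs⟩ := O2.exists_not_isOfFinOrder_of_infinite v' hvn.inr_zero
      (by rwa [hvv.range_lift])
    have hneg : ¬ ((1 : ℝ) = -1) := by norm_num
    rcases s with i | i
    · by_cases hi : i = ⟨0, hg⟩
      · subst hi
        simp [hvn.inl_zero, hneg, hfin] at hs
      · refine main i (hpos i hi) (Or.inl ?_)
        simpa [(hvn.rotationsAt i (hpos i hi)).1, hneg] using hs
    · by_cases hi : i = ⟨0, hg⟩
      · subst hi
        have hneg' : ¬ ((-1 : ℝ) = 1) := by norm_num
        simp [hvn.inr_zero, hneg', O2.mul_self_of_det hvn.inr_zero] at hs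
      · refine main i (hpos i hi) (Or.inr ?_)
        simpa [(hvn.rotationsAt i (hpos i hi)).2, hneg] using hs

end Main

/-! ### The orbit closure -/

section OrbitClosure

variable {g : ℕ}

theorem continuous_eval_hom (x : SurfaceGroup g) :
    Continuous fun ρ : SurfaceGroup g →* O2 => ρ x :=
  (continuous_apply x).comp continuous_induced_dom

theorem continuous_lift_apply {ι : Type*} (x : FreeGroup ι) :
    Continuous fun v : ι → O2 => FreeGroup.lift v x := by
  induction x using FreeGroup.induction_on with
  | C1 => simpa using continuous_const
  | of s => simpa using continuous_apply s
  | inv_of s h => simpa using! (continuous_apply s).inv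
  | mul x y hx hy => simpa using! hx.mul hy

theorem continuous_genTuple :
    Continuous (genTuple : (SurfaceGroup g →* O2) → Fin g ⊕ Fin g → O2) :=
  continuous_pi fun _ => continuous_eval_hom _

/-- `genTuple` is a homeomorphism onto the closed set `V` of solutions of the relation, with inverse
`F`. -/
theorem isClosed_image_genTuple {C : Set (SurfaceGroup g →* O2)} (hC : IsClosed C) :
    IsClosed (genTuple '' C) := by
  let V : Set (Fin g ⊕ Fin g → O2) := {v | FreeGroup.lift v (surfaceRelator g) = 1}
  have hV : IsClosed V := isClosed_eq (continuous_lift_apply _) continuous_const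
  let F (v : V) : SurfaceGroup g →* O2 := PresentedGroup.toGroup (f := v.1) (by
    rintro _ rfl
    exact v.2)
  have hF : Continuous F := by
    refine continuous_induced_rng.2 (continuous_pi fun x => ?_)
    obtain ⟨x, rfl⟩ := PresentedGroup.mk_surjective _ x
    exact (continuous_lift_apply x).comp continuous_subtype_val
  have hFg (v : V) : genTuple (F v) = v.1 := funext fun s => PresentedGroup.toGroup.of _
  convert hV.isClosedEmbedding_subtypeVal.isClosedMap _ (hC.preimage hF) using 1
  ext v
  constructor
  · rintro ⟨ρ, hρ, rfl⟩
    have hv : genTuple ρ ∈ V := (lift_surfaceRelator _).trans (relatorValue_genTuple ρ)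
    refine ⟨⟨genTuple ρ, hv⟩, ?_, rfl⟩
    have : F ⟨genTuple ρ, hv⟩ = ρ := genTuple_injective (hFg _)
    rwa [Set.mem_preimage, this]
  · rintro ⟨v, hv, rfl⟩
    exact ⟨F v, hv, hFg v⟩

theorem comp_mem_closure_orbit {ρ τ : SurfaceGroup g →* O2} (hτ : τ ∈ closure (autPlusOrbit ρ))
    {σ : MulAut (SurfaceGroup g)} (hσ : σ ∈ autPlus g) :
    τ.comp σ.toMonoidHom ∈ closure (autPlusOrbit ρ) := by
  have hcont : Continuous fun τ : SurfaceGroup g →* O2 => τ.comp σ.toMonoidHom :=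
    continuous_induced_rng.2 (continuous_pi fun x => continuous_eval_hom (σ x))
  refine map_mem_closure (f := fun τ => τ.comp σ.toMonoidHom) hcont hτ ?_
  rintro _ ⟨σ', hσ', rfl⟩
  exact ⟨σ' * σ, mul_mem hσ' hσ, rfl⟩

theorem epsO2_eq_one_iff (A : O2) : epsO2 A = 1 ↔ detO2 A = 1 := by
  rw [epsO2, QuotientGroup.mk'_apply, QuotientGroup.eq_one_iff, MonoidHom.mem_ker]

/-- The quotient has two elements, so the image is trivial or everything. -/
theorem range_epsO2_eq_iff {G : Type*} [Group G] (ρ ρ' : G →* O2) :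
    (epsO2.comp ρ').range = (epsO2.comp ρ).range ↔
      ((∀ x, detO2 (ρ' x) = 1) ↔ ∀ x, detO2 (ρ x) = 1) := by
  have hbot (τ : G →* O2) : (epsO2.comp τ).range = ⊥ ↔ ∀ x, detO2 (τ x) = 1 := by
    simp [MonoidHom.range_eq_bot_iff, DFunLike.ext_iff, epsO2_eq_one_iff]
  have htop (τ : G →* O2) (h : ¬ ∀ x, detO2 (τ x) = 1) : (epsO2.comp τ).range = ⊤ := by
    obtain ⟨x, hx⟩ := not_forall.1 h
    rw [eq_top_iff]
    intro q _
    obtain ⟨A, rfl⟩ := QuotientGroup.mk_surjective q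
    change epsO2 A ∈ _
    rcases O2.det_eq A with hA | hA
    · rw [(epsO2_eq_one_iff A).2 hA]
      exact one_mem _
    · refine ⟨x, ?_⟩
      change epsO2 (τ x) = _
      rw [← inv_mul_eq_one, ← map_inv, ← map_mul, epsO2_eq_one_iff]
      rw [← ne_eq, O2.det_ne_one] at hx
      have : detO2 (τ x)⁻¹ * detO2 (τ x) = 1 := by rw [← map_mul, inv_mul_cancel, map_one]
      rw [map_mul, hA]
      rwa [hx] at this
  constructor
  · intro h
    rw [← hbot, ← hbot, h]
  · intro h
    by_cases hρ : ∀ x, detO2 (ρ x) = 1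
    · rw [(hbot ρ).2 hρ, (hbot ρ').2 (h.2 hρ)]
    · rw [htop ρ hρ, htop ρ' fun h' => hρ (h.1 h')]

theorem forall_det_eq_one_iff (ρ : SurfaceGroup g →* O2) :
    (∀ x, detO2 (ρ x) = 1) ↔ ∀ s, detO2 (genTuple ρ s) = 1 := by
  refine ⟨fun h s => h _, fun h x => ?_⟩
  obtain ⟨x, rfl⟩ := PresentedGroup.mk_surjective _ x
  rw [← lift_genTuple]
  exact det_lift_eq_one h x

theorem sw_eq_sw_iff (ρ ρ' : SurfaceGroup g →* O2) :
    sw (O2.toPSL.comp ρ') = sw (O2.toPSL.comp ρ) ↔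
      (O2.obstruction (genTuple ρ') = 1 ↔ O2.obstruction (genTuple ρ) = 1) := by
  have h (τ : SurfaceGroup g →* O2) := O2.sw_toPSL_eq_zero_iff τ
  rw [← h, ← h]
  generalize sw (O2.toPSL.comp ρ) = a
  generalize sw (O2.toPSL.comp ρ') = b
  revert a b
  decide

theorem sw_comp_mulAut {G : Type} [Group G] (τ : G →* PSL2C) (σ : MulAut G) :
    sw (τ.comp σ.toMonoidHom) = sw τ := by
  unfold sw
  congr 1
  refine propext ⟨?_, ?_⟩
  · rintro ⟨ρ', h⟩
    refine ⟨ρ'.comp σ⁻¹.toMonoidHom, fun x => (h (σ⁻¹ x)).trans ?_⟩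
    exact congrArg τ (MulAut.apply_inv_self _ σ x)
  · rintro ⟨ρ', h⟩
    exact ⟨ρ'.comp σ.toMonoidHom, fun x => h (σ x)⟩

/-- Determinants and obstruction are continuous with values `±1`, so the negated conditions are
closed as well. -/
theorem isClosed_sameInvariants (ρ : SurfaceGroup g →* O2) :
    IsClosed {ρ' : SurfaceGroup g →* O2 | (epsO2.comp ρ').range = (epsO2.comp ρ).range ∧
      sw (O2.toPSL.comp ρ') = sw (O2.toPSL.comp ρ)} := by
  simp only [range_epsO2_eq_iff, sw_eq_sw_iff, forall_det_eq_one_iff, Set.ofPred_and]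
  have hd (s : Fin g ⊕ Fin g) : Continuous fun ρ' : SurfaceGroup g →* O2 => detO2 (genTuple ρ' s) :=
    O2.continuous_detO2.comp ((continuous_apply s).comp continuous_genTuple)
  have ho : Continuous fun ρ' : SurfaceGroup g →* O2 => O2.obstruction (genTuple ρ') :=
    O2.continuous_obstruction.comp continuous_genTuple
  refine IsClosed.inter ?_ ?_
  · by_cases h : ∀ s, detO2 (genTuple ρ s) = 1
    · simp only [h, implies_true, iff_true, Set.ofPred_forall]
      exact isClosed_iInter fun s => isClosed_eq (hd s) continuous_const
    · simp only [h, iff_false, not_forall, ← ne_eq, O2.det_ne_one, Set.ofPred_exists]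
      exact isClosed_iUnion_of_finite fun s => isClosed_eq (hd s) continuous_const
  · by_cases h : O2.obstruction (genTuple ρ) = 1
    · simp only [h, iff_true]
      exact isClosed_eq ho continuous_const
    · have (ρ' : SurfaceGroup g →* O2) :
          (O2.obstruction (genTuple ρ') = 1 ↔ O2.obstruction (genTuple ρ) = 1) ↔
            O2.obstruction (genTuple ρ') = -1 := by
        rcases O2.obstruction_eq _ (relatorValue_genTuple ρ') with h' | h' <;> rw [h'] <;>
          simp [h] <;> norm_num
      simp only [this]
      exact isClosed_eq ho continuous_const

end OrbitClosure

/-! ### The orbit closure theorem. -/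

theorem mainTheorem7 (g : ℕ) (ρ : SurfaceGroup g →* O2) (hρ : (Set.range ρ).Infinite) :
    closure (autPlusOrbit ρ) =
      {ρ' : SurfaceGroup g →* O2 | (epsO2.comp ρ').range = (epsO2.comp ρ).range ∧
        sw (O2.toPSL.comp ρ') = sw (O2.toPSL.comp ρ)} := by
  apply Set.Subset.antisymm
  · refine closure_minimal ?_ (isClosed_sameInvariants ρ)
    rintro _ ⟨σ, -, rfl⟩
    refine ⟨?_, sw_comp_mulAut (O2.toPSL.comp ρ) σ⟩
    rw [range_epsO2_eq_iff]
    exact ⟨fun h x => by simpa using h (σ.symm x), fun h x => h (σ x)⟩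
  · rintro ρ' ⟨h1, h2⟩
    rw [range_epsO2_eq_iff, forall_det_eq_one_iff, forall_det_eq_one_iff] at h1
    rw [sw_eq_sw_iff] at h2
    have hinv (φ) (hφ : φ ∈ relatorAut g) :
        ∀ v ∈ genTuple '' closure (autPlusOrbit ρ),
          tupleAct φ v ∈ genTuple '' closure (autPlusOrbit ρ) := by
      rintro _ ⟨τ, hτ, rfl⟩
      obtain ⟨σ, hσ, hσφ⟩ := exists_mem_autPlus_of_mem_relatorAut hφ
      refine ⟨_, comp_mem_closure_orbit hτ hσ, funext fun s => ?_⟩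
      rw [tupleAct, lift_genTuple, ← hσφ]
      rfl
    have hmem : genTuple ρ ∈ genTuple '' closure (autPlusOrbit ρ) :=
      ⟨ρ, subset_closure ⟨1, one_mem _, rfl⟩, rfl⟩
    have hrange : Set.range (FreeGroup.lift (genTuple ρ)) = Set.range ρ := by
      have : (FreeGroup.lift (genTuple ρ) : _ → O2) = ρ ∘ PresentedGroup.mk _ :=
        funext (lift_genTuple ρ)
      rw [this, (PresentedGroup.mk_surjective _).range_comp]
    obtain ⟨τ, hτ, hτρ⟩ := mem_of_invariants_eq (isClosed_image_genTuple isClosed_closure) hinv hmem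
      (by rwa [hrange]) (relatorValue_genTuple ρ) (relatorValue_genTuple ρ') h1 h2
    rwa [← genTuple_injective hτρ]
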